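/- **Setting.** Circuits over NOT and TOFFOLI are finite sequences of gates; the size is the number of gates. "Algorithm" means a program of a random access machine with unit-cost instructions (registers, indirectly addressed memory, successor/predecessor arithmetic) and an instruction producing a bit, which is a nondeterministic guess or a fair coin. It runs in time $T$ on an input if every computation path halts within $T$ steps. For a reversible circuit $C:\{0,1\}^{n+\xi}\to\{0,1\}^{n+\xi}$ over NOT and TOFFOLI let $$gap(C)=\sum_{x\in\{0,1\}^n}(-1)^{C_{n+\xi}(x0^{\xi})},$$ where $C_{n+\xi}(x0^\xi)$ is the last bit of $C(x0^\xi)$. Fix a function $\xi=\xi(n)$ with $\xi\in o(n)$. **Conjecture** (for $\xi$). There is a polynomial $p$ such that the following holds. Let $A$ be any nondeterministic $T(n)$-time algorithm which, given $n$, $\xi(n)$ and a description of a reversible circuit $C:\{0,1\}^{n+\xi(n)}\to\{0,1\}^{n+\xi(n)}$ of size at most $p(n)$ consisting only of NOT and TOFFOLI, accepts if $gap(C)\ne0$ and rejects if $gap(C)=0$. Then for every constant $a>0$, $T(n)>2^{(1-a)n}$ for infinitely many $n$. **HC1Q model.** An $N$-qubit HC1Q model consists of a reversible circuit $C$ on $N$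 bits (over NOT and TOFFOLI), a set of measured qubits, and an accepting outcome for them. Starting from $|0^N\rangle$ one applies $(H^{\otimes N-1}\otimes I)\,C\,(H^{\otimes N-1}\otimes I)$ and measures the chosen qubits in the computational basis; $p_{acc}$ is the probability of the accepting outcome. A probabilistic algorithm samples $p_{acc}$ in time $T$ within multiplicative error $\epsilon$ if, given the description of the model, it runs in time $T$ and accepts with a probability $q_{acc}$ satisfying $|p_{acc}-q_{acc}|\le\epsilon\,p_{acc}$. **Theorem.** Assume the conjecture for $\xi$. Then there is a polynomial $q$ such that for every constant $a>0$ and every classical probabilistic algorithm $A$ there are infinitely many $N$, each of the form $N=n+\xi(n)+2$, for which there exists an $N$-qubit HC1Q model with a circuit of size at most $q(N)$ whose acceptance probability $p_{acc}$ is not sampled by $A$ in time $2^{(1-a)(N-\xi(n)-2)}$ within any multiplicative error $\epsilon<1$. -/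

import Mathlib

open Filter Asymptotics

/-! ### Classical reversible circuits over NOT and TOFFOLI -/

/-- A NOT or TOFFOLI gate on `m` wires. In `toffoli i j k` the wires `i`, `j` are the controls
and `k` is the target. -/
inductive Gate (m : ℕ) : Type
  | not (i : Fin m) : Gate m
  | toffoli (i j k : Fin m) (hij : i ≠ j) (hik : i ≠ k) (hjk : j ≠ k) : Gate m

/-- The action of a gate on bit strings. -/
def Gate.eval {m : ℕ} : Gate m → (Fin m → Bool) → (Fin m → Bool)
  | .not i, x => Function.update x i (!(x i))
  | .toffoli i j k _ _ _, x => Function.update x k (xor (x k) (x i && x j))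

/-- The description of a gate by four natural numbers. -/
def Gate.encode {m : ℕ} : Gate m → List ℕ
  | .not i => [0, i, i, i]
  | .toffoli i j k _ _ _ => [1, i, j, k]

/-- A reversible circuit: a list of gates, the head being applied first. Its size is its length. -/
abbrev RevCircuit (m : ℕ) : Type := List (Gate m)

/-- The map `{0,1}^m → {0,1}^m` computed by a reversible circuit. -/
def RevCircuit.eval {m : ℕ} (C : RevCircuit m) (x : Fin m → Bool) : Fin m → Bool :=
  C.foldl (fun y g => g.eval y) x

/-- The concatenated descriptions of the gates. -/
def RevCircuit.encode {m : ℕ} (C : RevCircuit m) : List ℕ :=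
  C.flatMap Gate.encode

/-- The last bit of a bit string (`false` for the empty string). -/
def lastBit {m : ℕ} (x : Fin m → Bool) : Bool :=
  if h : 0 < m then x ⟨m - 1, Nat.sub_lt h Nat.one_pos⟩ else false

/-- `gap(C) = ∑_{x ∈ {0,1}^n} (-1)^{C_{n+k}(x 0^k)}`, the exponent being the last bit of
`C(x 0^k)`. -/
def gap (n k : ℕ) (C : RevCircuit (n + k)) : ℤ :=
  ∑ x : Fin n → Bool,
    (-1 : ℤ) ^ (lastBit (RevCircuit.eval C (Fin.append x (fun _ : Fin k => false)))).toNat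

/-- The input by which an algorithm is given a reversible circuit on `n` input bits and `k`
ancilla bits. -/
def gapInput (n k : ℕ) (C : RevCircuit (n + k)) : List ℕ :=
  n :: k :: RevCircuit.encode C

/-! ### Random access machines with a coin -/

namespace RAM

/-- Instructions of a random access machine with registers and an indirectly addressed memory,
both holding natural numbers, and with structured control flow. Since the only arithmetic is
`± 1`, a word never exceeds the largest input word by more than the number of steps made; hence
each instruction acts on words of logarithmic length and is charged one unit of time. -/
inductive Instr : Type
  | inc (r : ℕ) : Instr
  | dec (r : ℕ) : Instr
  | copy (r s : ℕ) : Instr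
  | load (r s : ℕ) : Instr
  | store (r s : ℕ) : Instr
  | coin (r : ℕ) : Instr
  | ifz (r : ℕ) (p q : List Instr) : Instr
  | loop (r : ℕ) (p : List Instr) : Instr

/-- A program (an algorithm) is a finite list of instructions. -/
abbrev Program : Type := List Instr

/-- A configuration: the code that remains to be executed, the registers, the memory. -/
structure Config : Type where
  code : List Instr
  reg : ℕ → ℕ
  mem : ℕ → ℕ

/-- One step. The bit `b` is the outcome of the coin of this step; only the instruction `coin`
looks at it. A configuration without remaining code has halted. -/
def step (b : Bool) (c : Config) : Config :=
  match c.code with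
  | [] => c
  | .inc r :: k => ⟨k, Function.update c.reg r (c.reg r + 1), c.mem⟩
  | .dec r :: k => ⟨k, Function.update c.reg r (c.reg r - 1), c.mem⟩
  | .copy r s :: k => ⟨k, Function.update c.reg r (c.reg s), c.mem⟩
  | .load r s :: k => ⟨k, Function.update c.reg r (c.mem (c.reg s)), c.mem⟩
  | .store r s :: k => ⟨k, c.reg, Function.update c.mem (c.reg r) (c.reg s)⟩
  | .coin r :: k => ⟨k, Function.update c.reg r b.toNat, c.mem⟩
  | .ifz r p q :: k => ⟨if c.reg r = 0 then p ++ k else q ++ k, c.reg, c.mem⟩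
  | .loop r p :: k => ⟨if c.reg r = 0 then k else p ++ .loop r p :: k, c.reg, c.mem⟩

/-- The run of as many steps as there are bits in the list, with these bits as coins. -/
def run (v : List Bool) (c : Config) : Config :=
  v.foldl (fun d b => step b d) c

/-- The initial configuration on the input word list `w`: the input stands in the first memory
cells, its length in register `0`, everything else is zero. -/
def start (A : Program) (w : List ℕ) : Config :=
  ⟨A, Function.update (fun _ => 0) 0 w.length, fun i => w.getD i 0⟩

/-- The configuration reached from the input `w` after `t` steps with coins `v`. -/
def after (A : Program) (w : List ℕ) {t : ℕ} (v : Fin t → Bool) : Config :=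
  run (List.ofFn v) (start A w)

/-- The machine has halted and accepts (its answer stands in register `1`). -/
def Config.Accepting (c : Config) : Prop := c.code = [] ∧ c.reg 1 ≠ 0

/-- On the input `w` the program runs in time `t`: every computation path halts within `t`
steps. -/
def RunsInTime (A : Program) (w : List ℕ) (t : ℕ) : Prop :=
  ∀ v : Fin t → Bool, (after A w v).code = []

/-- Nondeterministic acceptance within `t` steps: some computation path accepts. -/
def NAccepts (A : Program) (w : List ℕ) (t : ℕ) : Prop :=
  ∃ v : Fin t → Bool, (after A w v).Accepting

/-- The probability, over fair coins, of accepting within `t` steps. -/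
noncomputable def acceptProb (A : Program) (w : List ℕ) (t : ℕ) : ℝ :=
  (Nat.card {v : Fin t → Bool // (after A w v).Accepting} : ℝ) / 2 ^ t

/-- On the input `w` the probabilistic program `A` samples the probability `p` in time `T` within
the multiplicative error `ε`: it runs in time `T` and accepts with a probability `q` such that
`|p - q| ≤ ε p`. -/
def Samples (A : Program) (w : List ℕ) (T ε p : ℝ) : Prop :=
  RunsInTime A w ⌊T⌋₊ ∧ |p - acceptProb A w ⌊T⌋₊| ≤ ε * p

end RAM

/-! ### The conjecture on gaps of reversible circuits -/

/-- The nondeterministic algorithm `A` runs in time `T(n)` and, given a reversible circuit `C` on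
`n + ξ(n)` bits of size at most `p(n)`, accepts if `gap(C) ≠ 0` and rejects if `gap(C) = 0`. -/
def DecidesGap (ξ : ℕ → ℕ) (p : Polynomial ℕ) (A : RAM.Program) (T : ℕ → ℕ) : Prop :=
  ∀ (n : ℕ) (C : RevCircuit (n + ξ n)), C.length ≤ p.eval n →
    RAM.RunsInTime A (gapInput n (ξ n) C) (T n) ∧
      (RAM.NAccepts A (gapInput n (ξ n) C) (T n) ↔ gap n (ξ n) C ≠ 0)

/-- For some polynomial size bound, every nondeterministic `T(n)`-time algorithm that decides
whether the gap of a reversible circuit of that size with `ξ(n)` ancilla bits is nonzero has, for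
every `a > 0`, `T(n) > 2^{(1-a)n}` for infinitely many `n`. -/
def ReversibleGapConjecture (ξ : ℕ → ℕ) : Prop :=
  ∃ p : Polynomial ℕ, ∀ (A : RAM.Program) (T : ℕ → ℕ), DecidesGap ξ p A T →
    ∀ a : ℝ, 0 < a → ∃ᶠ n : ℕ in atTop, (2 : ℝ) ^ ((1 - a) * (n : ℝ)) < (T n : ℝ)

/-! ### The HC1Q model -/

/-- The entries of the one-qubit Hadamard gate. -/
noncomputable def hadamard (b c : Bool) : ℂ :=
  (1 / (Real.sqrt 2 : ℂ)) * (if b && c then -1 else 1)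

/-- The matrix of `H^{⊗ N-1} ⊗ I` in the computational basis. -/
noncomputable def hadamardLayer (N : ℕ) : Matrix (Fin N → Bool) (Fin N → Bool) ℂ :=
  fun x y => ∏ i : Fin N,
    if (i : ℕ) + 1 = N then (if x i = y i then 1 else 0) else hadamard (x i) (y i)

/-- The matrix of a reversible circuit, `|y⟩ ↦ |C(y)⟩`, in the computational basis. -/
noncomputable def RevCircuit.toMatrix {N : ℕ} (C : RevCircuit N) :
    Matrix (Fin N → Bool) (Fin N → Bool) ℂ :=
  fun x y => if x = RevCircuit.eval C y then 1 else 0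

/-- An `N`-qubit HC1Q model: a reversible circuit, the qubits that are measured (those with
`outcome i ≠ none`) and the outcome on which the model accepts (`outcome i = some b` if the
measurement of the qubit `i` has to give `b`). -/
structure HC1Q (N : ℕ) : Type where
  circuit : RevCircuit N
  outcome : Fin N → Option Bool

namespace HC1Q

variable {N : ℕ}

/-- The final state `(H^{⊗ N-1} ⊗ I) C (H^{⊗ N-1} ⊗ I) |0^N⟩`. -/
noncomputable def finalState (M : HC1Q N) : (Fin N → Bool) → ℂ :=
  (hadamardLayer N * RevCircuit.toMatrix M.circuit * hadamardLayer N).mulVec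
    (Pi.single (fun _ => false) 1)

/-- The acceptance probability `p_acc`: the probability that the measured qubits give the
accepting outcome. -/
noncomputable def acceptProb (M : HC1Q N) : ℝ :=
  ∑ z : Fin N → Bool,
    if ∀ (i : Fin N) (b : Bool), M.outcome i = some b → z i = b then ‖M.finalState z‖ ^ 2 else 0

/-- The description of an HC1Q model: number of qubits, accepting outcome (with `2` for a qubit
that is not measured), gates. -/
def encode (M : HC1Q N) : List ℕ :=
  N :: (List.ofFn (fun i => (M.outcome i).elim 2 Bool.toNat) ++ RevCircuit.encode M.circuit)

end HC1Q

/-! A sampler that beats the bound would decide nonvanishing of gaps too fast. Put k = ξ(n). To a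
circuit C on n + k bits one attaches an HC1Q model on n + k + 2 qubits with amplitude 2 gap(C) /
2^(n+k+1) at a fixed outcome, so that p_acc ≠ 0 iff gap(C) ≠ 0 (`finalState_gapModel`). Within
multiplicative error below 1, q_acc > 0 iff p_acc > 0, and q_acc > 0 says that some coin sequence
accepts; reading coins as guesses turns the sampler into a nondeterministic algorithm for gap(C) ≠ 0
(`Samples.nAccepts_iff`).

The Hadamard layer also puts the k ancillas of C into superposition, whereas the gap needs them to
be 0. A preliminary circuit adds the conjunction of the ancillas to the last qubit, which starts at
0, and then negates the ancillas. Demanding 1 on the last qubit keeps just the branch in which they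
were all 1 and have become 0. No clean work space is available, so the partial conjunctions are
added to k input wires of unknown content (`RevCircuit.chain_spec`); this requires k ≤ n, true for
large n since ξ ∈ o(n). On the kept branch these wires are all flipped, which only permutes the
inputs summed over. The final Hadamards, tested against the outcome with a 1 on the output wire of
C, supply the sign of the gap.

The model must be produced by the machine itself: an explicit program rewrites the input in place in
linear time and ends exactly in the initial configuration of `A` (`gapToHC1Q_steps`). The finitely
many n for which nothing is known about `A` are answered from a hard-wired table. The running time
poly(n) + 2^((1-a)n) is eventually at most 2^((1-a')n) for a' < min(a, 1), which contradicts the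
conjecture. -/

namespace RAM

/-! ### Runs of random access machines -/

theorem run_append (u v : List Bool) (c : Config) : run (u ++ v) c = run v (run u c) :=
  List.foldl_append

theorem run_halted (v : List Bool) {c : Config} (hc : c.code = []) : run v c = c := by
  induction v with
  | nil => rfl
  | cons b v ih =>
    have : step b c = c := by unfold step; rw [hc]
    rw [show run (b :: v) c = run v (step b c) from rfl, this, ih]

/-- Whatever the coins, `t` steps lead from `c` to `c'`. -/
def Steps (c : Config) (t : ℕ) (c' : Config) : Prop :=
  ∀ v : List Bool, v.length = t → run v c = c'

theorem Steps.refl (c : Config) : Steps c 0 c := by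
  intro v hv
  rw [List.length_eq_zero_iff.1 hv]; rfl

theorem Steps.trans {c d e : Config} {s t : ℕ} (h : Steps c s d) (h' : Steps d t e) :
    Steps c (s + t) e := by
  intro v hv
  rw [← List.take_append_drop s v, run_append, h _ (by simp; omega), h' _ (by simp; omega)]

theorem Steps.head {c d e : Config} {t : ℕ} (h : ∀ b, step b c = d) (h' : Steps d t e) :
    Steps c (t + 1) e := by
  intro v hv
  cases v with
  | nil => simp at hv
  | cons b v =>
    rw [show run (b :: v) c = run v (step b c) from rfl, h, h' v (by simpa using hv)]

/-- Every path from `c` halts within `t` steps. -/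
def HaltsIn (c : Config) (t : ℕ) : Prop :=
  ∀ v : List Bool, v.length = t → (run v c).code = []

/-- Some path from `c` accepts within `t` steps. -/
def AcceptsIn (c : Config) (t : ℕ) : Prop :=
  ∃ v : List Bool, v.length = t ∧ (run v c).Accepting

theorem runsInTime_iff (A : Program) (w : List ℕ) (t : ℕ) :
    RunsInTime A w t ↔ HaltsIn (start A w) t := by
  constructor
  · rintro h v rfl
    simpa [after] using h v.get
  · intro h v
    exact h _ (by simp)

theorem nAccepts_iff (A : Program) (w : List ℕ) (t : ℕ) :
    NAccepts A w t ↔ AcceptsIn (start A w) t := by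
  constructor
  · rintro ⟨v, hv⟩
    exact ⟨_, by simp, hv⟩
  · rintro ⟨v, rfl, hv⟩
    exact ⟨v.get, by simpa [after] using hv⟩

theorem HaltsIn.mono {c : Config} {t t' : ℕ} (h : HaltsIn c t) (htt' : t ≤ t') :
    HaltsIn c t' := by
  intro v hv
  rw [← List.take_append_drop t v, run_append]
  have := h (v.take t) (by simp; omega)
  rwa [run_halted _ this]

/-- Halted configurations are fixed by `step`, so coins after time `t` can be cut off or padded
freely. -/
theorem HaltsIn.acceptsIn_iff {c : Config} {t t' : ℕ} (h : HaltsIn c t) (htt' : t ≤ t') :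
    AcceptsIn c t' ↔ AcceptsIn c t := by
  constructor
  · rintro ⟨v, hv, hacc⟩
    have hl : (v.take t).length = t := by simp; omega
    refine ⟨v.take t, hl, ?_⟩
    rwa [← List.take_append_drop t v, run_append, run_halted _ (h _ hl)] at hacc
  · rintro ⟨v, hv, hacc⟩
    refine ⟨v ++ List.replicate (t' - t) false, by simp; omega, ?_⟩
    rwa [run_append, run_halted _ (h _ hv)]

theorem Steps.haltsIn {c d : Config} {s t : ℕ} (h : Steps c s d) (h' : HaltsIn d t) :
    HaltsIn c (s + t) := by
  intro v hv
  rw [← List.take_append_drop s v, run_append, h _ (by simp; omega)]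
  exact h' _ (by simp; omega)

theorem Steps.acceptsIn_iff {c d : Config} {s : ℕ} (h : Steps c s d) (t : ℕ) :
    AcceptsIn c (s + t) ↔ AcceptsIn d t := by
  constructor
  · rintro ⟨v, hv, hacc⟩
    refine ⟨v.drop s, by simp; omega, ?_⟩
    rwa [← List.take_append_drop s v, run_append, h _ (by simp; omega)] at hacc
  · rintro ⟨v, hv, hacc⟩
    refine ⟨List.replicate s false ++ v, by simp; omega, ?_⟩
    rwa [run_append, h _ (by simp)]

theorem haltsIn_zero {c : Config} (hc : c.code = []) : HaltsIn c 0 := by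
  intro v _
  rw [run_halted _ hc, hc]

theorem acceptsIn_zero_iff {c : Config} (hc : c.code = []) : AcceptsIn c 0 ↔ c.reg 1 ≠ 0 := by
  constructor
  · rintro ⟨v, -, hv⟩
    rw [run_halted _ hc] at hv
    exact hv.2
  · exact fun h => ⟨[], rfl, hc, h⟩

/-! ### Fair coins read as nondeterministic guesses -/

theorem acceptProb_pos_iff (A : Program) (w : List ℕ) (t : ℕ) :
    0 < acceptProb A w t ↔ NAccepts A w t := by
  unfold acceptProb NAccepts
  rw [div_pos_iff_of_pos_right (by positivity), Nat.cast_pos, Nat.card_pos_iff]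
  constructor
  · rintro ⟨⟨v, hv⟩, -⟩
    exact ⟨v, hv⟩
  · rintro ⟨v, hv⟩
    exact ⟨⟨v, hv⟩, inferInstance⟩

/-- Sampling within a multiplicative error `< 1` decides whether the probability is positive. -/
theorem Samples.nAccepts_iff {A : Program} {w : List ℕ} {T ε p : ℝ} (hp : 0 ≤ p) (hε : ε < 1)
    (h : Samples A w T ε p) : NAccepts A w ⌊T⌋₊ ↔ p ≠ 0 := by
  rw [← acceptProb_pos_iff]
  have h2 := abs_le.1 h.2
  -- For p = 0 the allowed error is 0, hence q = 0; for p > 0 one gets q ≥ (1 - ε) p > 0.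
  constructor
  · rintro hq rfl
    simp only [mul_zero, neg_zero, zero_sub] at h2
    linarith [h2.1]
  · intro hp0
    have hp1 : 0 < p := lt_of_le_of_ne hp (Ne.symm hp0)
    nlinarith [h2.2, mul_pos (sub_pos.2 hε) hp1]

/-! ### Branching on small words and table lookup -/

/-- Branch to `f v`, where `v` is the content of register `r` capped at `b`. -/
def switch (r : ℕ) : ℕ → (ℕ → Program) → Program
  | 0, f => f 0
  | b + 1, f => [.ifz r (f 0) (.dec r :: switch r b (fun v => f (v + 1)))]

/-- A test and a decrement per unit give the bound 2b. The register keeps its excess over `b`, which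
the code run afterwards has to tolerate. -/
theorem switch_steps (r b : ℕ) (f : ℕ → Program) (reg mem : ℕ → ℕ) :
    ∃ t ≤ 2 * b, Steps ⟨switch r b f, reg, mem⟩ t
      ⟨f (min (reg r) b), Function.update reg r (reg r - b), mem⟩ := by
  induction b generalizing f reg with
  | zero => exact ⟨0, le_rfl, by simpa [switch] using Steps.refl _⟩
  | succ b ih =>
    by_cases h : reg r = 0
    · refine ⟨0 + 1, by omega, Steps.head (d := ⟨f 0, reg, mem⟩) ?_ ?_⟩
      · intro c
        simp [step, switch, h]
      · have : Function.update reg r 0 = reg := by rw [← h, Function.update_eq_self]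
        simpa [h, this] using Steps.refl _
    · obtain ⟨t, ht, hs⟩ := ih (fun v => f (v + 1)) (Function.update reg r (reg r - 1))
      refine ⟨t + 1 + 1, by omega, Steps.head
        (d := ⟨.dec r :: switch r b (fun v => f (v + 1)), reg, mem⟩) ?_
        (Steps.head (d := ⟨switch r b (fun v => f (v + 1)),
          Function.update reg r (reg r - 1), mem⟩) ?_ ?_)⟩
      · intro c
        simp [step, switch, h]
      · intro c
        simp [step]
      · have h1 : min (reg r - 1) b + 1 = min (reg r) (b + 1) := by omega
        have h2 : reg r - 1 - b = reg r - (b + 1) := by omega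
        simpa [h1, h2] using hs

/-- Read `l` further memory words, each at most `b`, from the address in register `2`, append them
to `acc`, and increment register `1` if the resulting list satisfies `f`. -/
def lookup (f : List ℕ → Bool) (b : ℕ) : ℕ → List ℕ → Program
  | 0, acc => if f acc then [.inc 1] else []
  | l + 1, acc => .load 3 2 :: .inc 2 :: switch 3 b (fun v => lookup f b l (acc ++ [v]))

/-- The code is a finite decision tree with the values of `f` built into its leaves, so `f` need not
be computable. -/
theorem lookup_steps (f : List ℕ → Bool) (b : ℕ) (w acc : List ℕ) (reg mem : ℕ → ℕ)
    (hb : ∀ x ∈ w, x ≤ b) (hmem : ∀ i < w.length, mem (reg 2 + i) = w.getD i 0)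
    (h1 : reg 1 = 0) :
    ∃ t ≤ w.length * (2 * b + 2) + 1, ∃ c, Steps ⟨lookup f b w.length acc, reg, mem⟩ t c ∧
      c.code = [] ∧ (c.reg 1 ≠ 0 ↔ f (acc ++ w) = true) := by
  induction w generalizing acc reg with
  | nil =>
    by_cases h : f acc
    · refine ⟨1, by simp, ⟨[], Function.update reg 1 (reg 1 + 1), mem⟩,
        Steps.head ?_ (Steps.refl _), rfl, by simp [h]⟩
      intro c
      simp [step, lookup, h]
    · exact ⟨0, by simp, ⟨[], reg, mem⟩, by simpa [lookup, h] using Steps.refl _, rfl,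
        by simp [h, h1]⟩
  | cons x w ih =>
    have hx : mem (reg 2) = x := by simpa using hmem 0 (by simp)
    set reg' := Function.update (Function.update reg 3 x) 2 (reg 2 + 1) with hreg'
    obtain ⟨t, ht, hs⟩ := switch_steps 3 b (fun v => lookup f b w.length (acc ++ [v])) reg' mem
    have h3 : reg' 3 = x := by simp [hreg']
    rw [h3, min_eq_left (hb x (by simp))] at hs
    obtain ⟨t', ht', c, hc, hc'⟩ := ih (acc ++ [x]) (Function.update reg' 3 (x - b))
      (fun y hy => hb y (by simp [hy]))
      (by
        intro i hi
        have := hmem (i + 1) (by simpa using hi)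
        simpa [hreg', add_assoc, add_comm 1 i] using this)
      (by simp [hreg', h1])
    refine ⟨t + t' + 1 + 1, ?_, c, Steps.head (d := ⟨.inc 2 :: switch 3 b
      (fun v => lookup f b w.length (acc ++ [v])), Function.update reg 3 x, mem⟩) ?_
      (Steps.head (d := ⟨switch 3 b (fun v => lookup f b w.length (acc ++ [v])), reg', mem⟩) ?_
        (hs.trans hc)), by simpa using hc'⟩
    · simp only [List.length_cons]
      nlinarith
    · intro d
      simp [step, lookup, hx]
    · intro d
      simp [step, hreg']

/-- A program with hard-wired answers for the inputs of length at most `l` with words at most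
`b`. -/
def table (f : List ℕ → Bool) (b l : ℕ) : Program :=
  switch 0 l (fun i => lookup f b i [])

theorem table_steps (f : List ℕ → Bool) (b l : ℕ) (w : List ℕ) (reg mem : ℕ → ℕ)
    (hb : ∀ x ∈ w, x ≤ b) (hl : w.length ≤ l) (h0 : reg 0 = w.length) (h1 : reg 1 = 0)
    (h2 : reg 2 = 0) (hmem : ∀ i, mem i = w.getD i 0) :
    ∃ t ≤ 2 * l + (l * (2 * b + 2) + 1), ∃ c, Steps ⟨table f b l, reg, mem⟩ t c ∧
      c.code = [] ∧ (c.reg 1 ≠ 0 ↔ f w = true) := by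
  obtain ⟨t, ht, hs⟩ := switch_steps 0 l (fun i => lookup f b i []) reg mem
  rw [h0, min_eq_left hl] at hs
  obtain ⟨t', ht', c, hc, hc'⟩ := lookup_steps f b w [] (Function.update reg 0 (w.length - l)) mem
    hb (by intro i _; simp [h2, hmem]) (by simp [h1])
  refine ⟨t + t', ?_, c, hs.trans hc, by simpa using hc'⟩
  have : w.length * (2 * b + 2) ≤ l * (2 * b + 2) := Nat.mul_le_mul_right _ hl
  omega

/-- Answer the inputs with first word `< m` from a table and run `A` on the others. -/
def withTable (f : List ℕ → Bool) (b l m : ℕ) (A : Program) : Program :=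
  .load 1 2 :: switch 1 m (fun i => if i < m then table f b l else A)

/-- Register `2` is initially 0, so the first instruction reads the first input word. The only trace
of the test is the remainder in register `1`. -/
theorem withTable_start_steps (f : List ℕ → Bool) (b l m : ℕ) (A : Program) (w : List ℕ) :
    ∃ t ≤ 2 * m + 1, Steps (start (withTable f b l m A) w) t
      ⟨if w.getD 0 0 < m then table f b l else A,
        Function.update (start A w).reg 1 (w.getD 0 0 - m), (start A w).mem⟩ := by
  obtain ⟨t, ht, hs⟩ := switch_steps 1 m (fun i => if i < m then table f b l else A)
    (Function.update (start A w).reg 1 (w.getD 0 0)) (start A w).mem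
  refine ⟨t + 1, by omega, Steps.head ?_ (by simpa using hs)⟩
  intro c
  simp [step, start, withTable]

theorem withTable_of_lt (f : List ℕ → Bool) (b l m : ℕ) (A : Program) (w : List ℕ)
    (hw : w.getD 0 0 < m) (hb : ∀ x ∈ w, x ≤ b) (hl : w.length ≤ l) :
    HaltsIn (start (withTable f b l m A) w) (2 * m + 1 + (2 * l + (l * (2 * b + 2) + 1))) ∧
      (AcceptsIn (start (withTable f b l m A) w)
        (2 * m + 1 + (2 * l + (l * (2 * b + 2) + 1))) ↔ f w = true) := by
  obtain ⟨t, ht, hs⟩ := withTable_start_steps f b l m A w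
  rw [if_pos hw, Nat.sub_eq_zero_of_le hw.le] at hs
  obtain ⟨t', ht', c, hc, hc1, hc2⟩ := table_steps f b l w
    (Function.update (start A w).reg 1 0) (start A w).mem hb hl (by simp [start])
    (by simp) (by simp [start]) (fun i => rfl)
  have hst := hs.trans hc
  have hh := hst.haltsIn (haltsIn_zero hc1)
  have hle : t + t' + 0 ≤ 2 * m + 1 + (2 * l + (l * (2 * b + 2) + 1)) := by omega
  refine ⟨hh.mono hle, ?_⟩
  rw [hh.acceptsIn_iff hle, hst.acceptsIn_iff, acceptsIn_zero_iff hc1, hc2]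

/-! ### Time-bounded weakest preconditions for deterministic code -/

/-- The register file with the contents `l`, followed by zeros. -/
def regs (l : List ℕ) : ℕ → ℕ := fun i => l.getD i 0

theorem update_regs {l : List ℕ} {r : ℕ} (hr : r < l.length) (x : ℕ) :
    Function.update (regs l) r x = regs (l.set r x) := by
  funext i
  by_cases h : i = r
  · subst h
    simp [regs, hr]
  · simp [regs, h, List.getD_eq_getElem?_getD, List.getElem?_set_ne (Ne.symm h)]

/-- Within `T` steps the code `p` leads from registers `l` and memory `m` to registers and memory
satisfying `Q`. -/
def Wp (p : Program) (T : ℕ) (l : List ℕ) (m : ℕ → ℕ) (Q : List ℕ → (ℕ → ℕ) → Prop) : Prop :=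
  ∃ t ≤ T, ∃ l' m', Q l' m' ∧ ∀ k, Steps ⟨p ++ k, regs l, m⟩ t ⟨k, regs l', m'⟩

variable {p q : Program} {T T' : ℕ} {l : List ℕ} {m : ℕ → ℕ} {Q Q' : List ℕ → (ℕ → ℕ) → Prop}

theorem Wp.nil (h : Q l m) : Wp [] T l m Q :=
  ⟨0, Nat.zero_le _, l, m, h, fun _ => Steps.refl _⟩

theorem Wp.mono (h : Wp p T l m Q) (hT : T ≤ T') (hQ : ∀ l m, Q l m → Q' l m) :
    Wp p T' l m Q' := by
  obtain ⟨t, ht, l', m', hq, hs⟩ := h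
  exact ⟨t, ht.trans hT, l', m', hQ _ _ hq, hs⟩

theorem Wp.append (h : Wp p T l m (fun l' m' => Wp q T' l' m' Q)) :
    Wp (p ++ q) (T + T') l m Q := by
  obtain ⟨t, ht, l', m', ⟨t', ht', l'', m'', hq, hs'⟩, hs⟩ := h
  refine ⟨t + t', Nat.add_le_add ht ht', l'', m'', hq, fun k => ?_⟩
  rw [List.append_assoc]
  exact (hs _).trans (hs' k)

theorem Wp.cons {i : Instr} {l' : List ℕ} {m' : ℕ → ℕ}
    (hi : ∀ k b, step b ⟨i :: k, regs l, m⟩ = ⟨k, regs l', m'⟩) (h : Wp p T l' m' Q) :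
    Wp (i :: p) (T + 1) l m Q := by
  obtain ⟨t, ht, l'', m'', hq, hs⟩ := h
  exact ⟨t + 1, by omega, l'', m'', hq, fun k => Steps.head (hi (p ++ k)) (hs k)⟩

theorem Wp.inc {r : ℕ} (hr : r < l.length) (h : Wp p T (l.set r (l.getD r 0 + 1)) m Q) :
    Wp (.inc r :: p) (T + 1) l m Q :=
  h.cons fun k b => by simp [step, ← update_regs hr, regs]

theorem Wp.dec {r : ℕ} (hr : r < l.length) (h : Wp p T (l.set r (l.getD r 0 - 1)) m Q) :
    Wp (.dec r :: p) (T + 1) l m Q :=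
  h.cons fun k b => by simp [step, ← update_regs hr, regs]

theorem Wp.copy {r s : ℕ} (hr : r < l.length) (h : Wp p T (l.set r (l.getD s 0)) m Q) :
    Wp (.copy r s :: p) (T + 1) l m Q :=
  h.cons fun k b => by simp [step, ← update_regs hr, regs]

theorem Wp.load {r s : ℕ} (hr : r < l.length) (h : Wp p T (l.set r (m (l.getD s 0))) m Q) :
    Wp (.load r s :: p) (T + 1) l m Q :=
  h.cons fun k b => by simp [step, ← update_regs hr, regs]

theorem Wp.store {r s : ℕ} (h : Wp p T l (Function.update m (l.getD r 0) (l.getD s 0)) Q) :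
    Wp (.store r s :: p) (T + 1) l m Q :=
  h.cons fun k b => by simp [step, regs]

theorem Wp.ifz {r : ℕ} {p₀ p₁ : Program}
    (h : Wp (if l.getD r 0 = 0 then p₀ else p₁) T l m (fun l' m' => Wp q T' l' m' Q)) :
    Wp (.ifz r p₀ p₁ :: q) (T + T' + 1) l m Q := by
  obtain ⟨t, ht, l'', m'', hq, hs⟩ := h.append
  refine ⟨t + 1, by omega, l'', m'', hq, fun k => Steps.head ?_ (hs k)⟩
  intro b
  by_cases h0 : l.getD r 0 = 0 <;> simp only [List.cons_append, step, regs, h0, if_true, if_false,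
    List.append_assoc]

/-- The loop rule, for an invariant indexed by the number of remaining rounds. -/
theorem Wp.loop {r c : ℕ} (I : ℕ → List ℕ → (ℕ → ℕ) → Prop) (hc : I c l m)
    (hI : ∀ j l m, j < c → I (j + 1) l m → l.getD r 0 ≠ 0 ∧ Wp p T l m (I j))
    (h0 : ∀ l m, I 0 l m → l.getD r 0 = 0) :
    Wp [.loop r p] (c * (T + 1) + 1) l m (I 0) := by
  induction c generalizing l m with
  | zero =>
    refine ⟨0 + 1, by simp, l, m, hc, fun k => Steps.head ?_ (Steps.refl _)⟩
    intro b
    have h : regs l r = 0 := h0 l m hc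
    simp [step, h]
  | succ c ih =>
    obtain ⟨hr, t, ht, l', m', hq, hs⟩ := hI c l m (Nat.lt_succ_self c) hc
    obtain ⟨t', ht', l'', m'', hq', hs'⟩ := ih hq fun j l m hj => hI j l m (by omega)
    refine ⟨t + t' + 1, ?_, l'', m'', hq', fun k => Steps.head
      (d := ⟨p ++ (.loop r p :: k), regs l, m⟩) ?_ ((hs _).trans (hs' k))⟩
    · rw [Nat.succ_mul]
      omega
    · intro b
      have h : regs l r ≠ 0 := hr
      simp [step, h]

/-- Add `s` times the content of register `6` to register `r`, and clear register `6`. -/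
def addMul (r s : ℕ) : Program := [.loop 6 (List.replicate s (.inc r) ++ [.dec 6])]

theorem Wp.replicate_inc {r : ℕ} (s : ℕ) (hr : r < l.length)
    (h : Wp p T (l.set r (l.getD r 0 + s)) m Q) :
    Wp (List.replicate s (.inc r) ++ p) (T + s) l m Q := by
  induction s generalizing l with
  | zero =>
    have : l.set r (l.getD r 0) = l := by
      rw [List.getD_eq_getElem _ _ hr, List.set_getElem_self]
    simpa only [List.replicate_zero, List.nil_append, add_zero, this] using h
  | succ s ih =>
    refine Wp.inc hr (ih (by simpa using hr) ?_)
    rw [List.set_set, List.getD_eq_getElem _ _ (by simpa using hr), List.getElem_set_self,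
      add_assoc, add_comm 1 s]
    exact h

theorem addMul_wp {r s : ℕ} (hr : r < l.length) (h6 : 6 < l.length) (hr6 : r ≠ 6) :
    Wp (addMul r s) (l.getD 6 0 * (s + 2) + 1) l m
      (fun l' m' => l' = (l.set r (l.getD r 0 + s * l.getD 6 0)).set 6 0 ∧ m' = m) := by
  refine Wp.mono (Wp.loop (c := l.getD 6 0) (T := 1 + s) (fun j l' m' =>
    l' = (l.set r (l.getD r 0 + s * (l.getD 6 0 - j))).set 6 j ∧ m' = m) ?_ ?_ ?_) ?_ ?_
  · simp only [Nat.sub_self, mul_zero, add_zero, and_true]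
    rw [List.getD_eq_getElem _ _ hr, List.set_getElem_self, List.getD_eq_getElem _ _ h6,
      List.set_getElem_self]
  · rintro j l' m' hj ⟨rfl, rfl⟩
    refine ⟨by simp [h6], Wp.replicate_inc s (by simpa using hr) (Wp.dec (by simpa using h6)
      (Wp.nil ⟨?_, rfl⟩))⟩
    have hj' : l.getD 6 0 - j = l.getD 6 0 - (j + 1) + 1 := by omega
    rw [hj']
    apply List.ext_getElem (by simp)
    intro i h1 h2
    by_cases hi6 : i = 6
    · subst hi6
      simp [List.getD_eq_getElem?_getD, List.getElem?_set, hr6, h6]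
    · by_cases hir : i = r
      · subst hir
        simp [List.getD_eq_getElem?_getD, List.getElem?_set, Ne.symm hi6, hr]
        ring
      · simp [Ne.symm hi6, Ne.symm hir]
  · rintro l' m' ⟨rfl, -⟩
    simp [h6]
  · rw [show 1 + s + 1 = s + 2 by ring]
  · rintro l' m' ⟨rfl, rfl⟩
    simp

/-! ### Writing a word list downwards -/

/-- From address `d` on, the memory holds the list `L`, followed by zeros. -/
def Holds (d : ℕ) (L : List ℕ) (m : ℕ → ℕ) : Prop :=
  ∀ i, d ≤ i → m i = L.getD (i - d) 0

theorem Holds.cons {d : ℕ} {L : List ℕ} (h : Holds (d + 1) L m) (v : ℕ) :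
    Holds d (v :: L) (Function.update m d v) := by
  intro i hi
  rcases Nat.eq_or_lt_of_le hi with rfl | hi
  · simp
  · rw [Function.update_of_ne (by omega), h i hi, show i - d = i - (d + 1) + 1 by omega,
      List.getD_cons_succ]

/-- Write the contents of the listed registers to memory, below the address in register `3`. -/
def emit : List ℕ → Program
  | [] => []
  | r :: rs => .dec 3 :: .store 3 r :: emit rs

/-- Addresses descend, so the register written first becomes the last word; register lists in later
programs are therefore to be read backwards. -/
theorem Wp.emit (rs : List ℕ) (d : ℕ) {L : List ℕ} (h3 : 3 < l.length) (hrs : 3 ∉ rs)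
    (hd : l.getD 3 0 = d + rs.length) (hL : Holds (d + rs.length) L m)
    (h : ∀ m', Holds d ((rs.map (l.getD · 0)).reverse ++ L) m' → Wp p T (l.set 3 d) m' Q) :
    Wp (emit rs ++ p) (T + 2 * rs.length) l m Q := by
  induction rs generalizing l m L with
  | nil =>
    have : l.set 3 d = l := by
      rw [← show l.getD 3 0 = d from hd, List.getD_eq_getElem _ _ h3, List.set_getElem_self]
    have h' := h m hL
    rwa [this] at h'
  | cons r rs ih =>
    simp only [List.mem_cons, not_or] at hrs
    refine Wp.dec h3 (Wp.store (ih (L := l.getD r 0 :: L) (by simpa using h3) hrs.2 ?_ ?_ ?_))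
    · rw [hd]
      simp [h3, ← add_assoc]
    · have hr : (l.set 3 (l.getD 3 0 - 1)).getD r 0 = l.getD r 0 := by
        simp [List.getD_eq_getElem?_getD, List.getElem?_set_ne hrs.1]
      have hd' : (l.set 3 (l.getD 3 0 - 1)).getD 3 0 = d + rs.length := by
        rw [hd]
        simp [h3, ← add_assoc]
      rw [hr, hd']
      exact Holds.cons hL _
    · intro m' hm'
      have hmap : rs.map ((l.set 3 (l.getD 3 0 - 1)).getD · 0) = rs.map (l.getD · 0) := by
        refine List.map_congr_left fun s hs => ?_
        have : 3 ≠ s := fun h => hrs.2 (h ▸ hs)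
        simp [List.getD_eq_getElem?_getD, List.getElem?_set_ne this]
      rw [hmap] at hm'
      simpa using h m' (by simpa using hm')

/-! ### The program that turns the description of a circuit into that of an HC1Q model -/

/-- Shift the gates of the input upwards. -/
def shiftGates : Program :=
  [.load 1 10, .inc 11, .load 2 11, .copy 4 0, .copy 5 0, .dec 5, .dec 5, .copy 6 1] ++
    (addMul 0 1 ++ ([.copy 6 2] ++ (addMul 0 13 ++
    ([.inc 0, .inc 0, .inc 0, .inc 0, .inc 0, .copy 3 0] ++
    [.loop 5 [.dec 4, .dec 3, .load 6 4, .store 3 6, .dec 5]]))))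

/-- The offset n + 13k + 7 is the room for one word for N, n + k + 2 outcome words, and four words
for each of the 3k + 1 gates of the chain. The value `x` stands for the remainder left by `switch`.
-/
theorem shiftGates_wp (n k : ℕ) (w : List ℕ) (x : ℕ) (hmem : ∀ i, m i = (n :: k :: w).getD i 0) :
    Wp shiftGates
      (8 + (n * 3 + 1 + (1 + (k * 15 + 1 + (6 + (w.length * (5 + 1) + 1))))))
      [w.length + 2, x, 0, 0, 0, 0, 0, 0, 0, 0, 0, 0, 0] m
      (fun l' m' => (∃ v, l' = [w.length + n + 13 * k + 7, n, k, n + 13 * k + 7, 2, 0, v, 0, 0, 0,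
        0, 1, 0]) ∧ Holds (n + 13 * k + 7) w m') := by
  unfold shiftGates
  have hn : m 0 = n := by simp [hmem]
  have hk : m 1 = k := by simp [hmem]
  refine Wp.append ?_
  refine Wp.load (by simp) <| Wp.inc (by simp) <| Wp.load (by simp) <| Wp.copy (by simp) <|
    Wp.copy (by simp) <| Wp.dec (by simp) <| Wp.dec (by simp) <| Wp.copy (by simp) <| Wp.nil ?_
  simp only [List.set_cons_succ, List.set_cons_zero, List.getD_cons_succ, List.getD_cons_zero,
    hn, hk, zero_add]
  refine Wp.append (Wp.mono (addMul_wp (by simp) (by simp) (by simp)) (by simp) ?_)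
  rintro _ _ ⟨rfl, rfl⟩
  refine Wp.append (Wp.copy (by simp) <| Wp.nil ?_)
  refine Wp.append (Wp.mono (addMul_wp (by simp) (by simp) (by simp)) (by simp) ?_)
  rintro _ _ ⟨rfl, rfl⟩
  refine Wp.append (Wp.inc (by simp) <| Wp.inc (by simp) <| Wp.inc (by simp) <|
    Wp.inc (by simp) <| Wp.inc (by simp) <| Wp.copy (by simp) <| Wp.nil ?_)
  simp only [List.set_cons_succ, List.set_cons_zero, List.getD_cons_succ, List.getD_cons_zero]
  -- Here `j` words are still to be moved. The highest goes first, so overlapping source and target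
  -- ranges do no harm.
  refine Wp.mono (Wp.loop (c := w.length) (fun j l' m' =>
    (∃ v, l' = [w.length + n + 13 * k + 7, n, k, n + 13 * k + 7 + j, 2 + j, j, v, 0, 0, 0, 0, 1,
      0]) ∧ (∀ i < j, m' (2 + i) = w.getD i 0) ∧ Holds (n + 13 * k + 7 + j) (w.drop j) m')
    ?_ ?_ ?_) le_rfl ?_
  · refine ⟨⟨0, ?_⟩, ?_, ?_⟩
    · simp only [List.cons.injEq, true_and, and_true]
      omega
    · intro i _
      rw [hmem, add_comm 2 i]
      rfl
    · intro i hi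
      rw [hmem, List.getD_eq_default _ _ (by simp; omega), List.drop_length]
      rfl
  · rintro j l' m' hj ⟨⟨v, rfl⟩, hlow, hhigh⟩
    refine ⟨by simp, Wp.dec (by simp) <| Wp.dec (by simp) <| Wp.load (by simp) <| Wp.store <|
      Wp.dec (by simp) <| Wp.nil ⟨⟨m' (2 + j), ?_⟩, ?_, ?_⟩⟩
    · simp [← add_assoc]
    · intro i hi
      simp only [List.set_cons_succ, List.set_cons_zero, List.getD_cons_succ, List.getD_cons_zero]
      rw [Function.update_of_ne (by omega), hlow i (by omega)]
    · simp only [List.set_cons_succ, List.set_cons_zero, List.getD_cons_succ, List.getD_cons_zero,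
        ← add_assoc, Nat.add_sub_cancel]
      rw [hlow j (by omega), List.drop_eq_getElem_cons hj, List.getD_eq_getElem _ _ hj]
      exact hhigh.cons _
  · rintro l' m' ⟨⟨v, rfl⟩, -⟩
    simp
  · rintro l' m' ⟨hl, -, hm⟩
    exact ⟨hl, hm⟩

/-- The `j`-th wire of the chain of targets: the input wires `0, …, k - 1`, then the last wire. -/
def chainWire (n k j : ℕ) : ℕ := if j < k then j else n + k + 1

/-- The description of the ascending part of the chain, from link `i` on. -/
def ascWords (n k i len : ℕ) : List ℕ :=
  (List.range' i len).flatMap fun j =>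
    [1, chainWire n k j, n + j, chainWire n k (j + 1), 0, n + j, n + j, n + j]

/-- The description of the descending part of the chain, from link `i - 1` down to link `0`. -/
def descWords (n k : ℕ) : ℕ → List ℕ
  | 0 => []
  | i + 1 => [1, chainWire n k i, n + i, chainWire n k (i + 1)] ++ descWords n k i

/-- Write the ascending part of the chain. -/
def writeAsc : Program :=
  [.copy 9 1, .copy 6 2] ++ (addMul 9 1 ++ ([.copy 7 9, .inc 7, .copy 12 7, .copy 8 2] ++
    [.loop 8 ([.dec 8, .dec 9] ++ (emit [9, 9, 9, 10, 7, 9, 8, 11] ++ [.copy 7 8]))]))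

/-- Register 3 is the write pointer, 7 the target of the next link, 8 and 9 hold j and n + j, 10 and
11 the constants 0 and 1, 12 the last wire. Link k - 1 is written first, and only its target is the
last wire. -/
theorem writeAsc_wp (len n k D v : ℕ) (L : List ℕ) (hL : Holds (D + 8 * k) L m) :
    Wp writeAsc (2 + (k * 3 + 1 + (4 + (k * (2 + (1 + 2 * 8) + 1) + 1))))
      [len, n, k, D + 8 * k, 2, 0, v, 0, 0, 0, 0, 1, 0] m
      (fun l' m' => l' = [len, n, k, D, 2, 0, 0, chainWire n k 0, 0, n, 0, 1, n + k + 1] ∧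
        Holds D (ascWords n k 0 k ++ L) m') := by
  unfold writeAsc
  refine Wp.append (Wp.copy (by simp) <| Wp.copy (by simp) <| Wp.nil ?_)
  refine Wp.append (Wp.mono (addMul_wp (by simp) (by simp) (by simp)) (by simp) ?_)
  rintro _ _ ⟨rfl, rfl⟩
  refine Wp.append (Wp.copy (by simp) <| Wp.inc (by simp) <| Wp.copy (by simp) <|
    Wp.copy (by simp) <| Wp.nil ?_)
  simp only [List.set_cons_succ, List.set_cons_zero, List.getD_cons_succ, List.getD_cons_zero,
    one_mul]
  refine Wp.mono (Wp.loop (c := k) (fun j l' m' => j ≤ k ∧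
    l' = [len, n, k, D + 8 * j, 2, 0, 0, chainWire n k j, j, n + j, 0, 1, n + k + 1] ∧
      Holds (D + 8 * j) (ascWords n k j (k - j) ++ L) m') ?_ ?_ ?_) le_rfl ?_
  · refine ⟨le_rfl, ?_, by simpa [ascWords] using hL⟩
    simp [chainWire]
  · rintro j l' m' hj ⟨-, rfl, hm⟩
    refine ⟨by simp, Wp.append (Wp.dec (by simp) <| Wp.dec (by simp) <| Wp.nil ?_)⟩
    simp only [List.set_cons_succ, List.set_cons_zero, List.getD_cons_succ, List.getD_cons_zero,
      ← add_assoc, Nat.add_sub_cancel]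
    refine Wp.emit [9, 9, 9, 10, 7, 9, 8, 11] (D + 8 * j) (by simp) (by simp) rfl hm fun m'' hm' =>
      Wp.copy (by simp) <| Wp.nil ⟨hj.le, ?_, ?_⟩
    · simp [chainWire, hj]
    · have : k - j = k - (j + 1) + 1 := by omega
      rw [this, ascWords, List.range'_succ, List.flatMap_cons, ← ascWords]
      simpa [chainWire, hj] using hm'
  · rintro l' m' ⟨-, rfl, -⟩
    simp
  · rintro l' m' ⟨-, rfl, hm⟩
    exact ⟨by simp, by simpa using hm⟩

/-- Write the middle and the descending part of the chain. -/
def writeDesc : Program :=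
  emit [7, 7, 7, 10] ++ ([.copy 5 2] ++
    [.loop 5 ([.dec 5, .copy 7 8, .inc 7, .ifz 5 [.copy 7 12] []] ++
      (emit [7, 9, 8, 11] ++ [.inc 8, .inc 9]))])

/-- Register 8 now counts upwards, so link k - 1 lands at the lowest address and is applied first.
Register 5 reaching 0 signals the link whose target is the last wire. -/
theorem writeDesc_wp (len n k D : ℕ) (L : List ℕ) (hL : Holds (D + 4 * k + 4) L m) :
    Wp writeDesc (1 + (k * (3 + 2 + (2 + 2 * 4) + 1) + 1) + 2 * 4)
      [len, n, k, D + 4 * k + 4, 2, 0, 0, chainWire n k 0, 0, n, 0, 1, n + k + 1] m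
      (fun l' m' => (∃ x, l' = [len, n, k, D, 2, 0, 0, x, k, n + k, 0, 1, n + k + 1]) ∧
        Holds D (descWords n k k ++
          ([0, chainWire n k 0, chainWire n k 0, chainWire n k 0] ++ L)) m') := by
  unfold writeDesc
  refine Wp.emit [7, 7, 7, 10] (D + 4 * k) (by simp) (by simp) rfl hL fun m' hm' => ?_
  refine Wp.append (Wp.copy (by simp) <| Wp.nil ?_)
  simp only [List.set_cons_succ, List.set_cons_zero, List.getD_cons_succ, List.getD_cons_zero]
  refine Wp.mono (Wp.loop (c := k) (fun j l' m' => j ≤ k ∧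
    (∃ x, l' = [len, n, k, D + 4 * j, 2, j, 0, x, k - j, n + (k - j), 0, 1, n + k + 1]) ∧
      Holds (D + 4 * j) (descWords n k (k - j) ++
        ([0, chainWire n k 0, chainWire n k 0, chainWire n k 0] ++ L)) m') ?_ ?_ ?_) le_rfl ?_
  · exact ⟨le_rfl, ⟨chainWire n k 0, by simp⟩, by simpa [descWords] using hm'⟩
  · rintro j l' m' hj ⟨-, ⟨x, rfl⟩, hm⟩
    obtain ⟨i, hi⟩ : ∃ i, k - (j + 1) = i := ⟨_, rfl⟩
    have hi' : k - j = i + 1 := by omega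
    refine ⟨by simp, Wp.append (T := 5) (T' := 2 + 2 * 4) ?_⟩
    refine Wp.dec (by simp) <| Wp.copy (by simp) <| Wp.inc (by simp) ?_
    simp only [List.set_cons_succ, List.set_cons_zero, List.getD_cons_succ, List.getD_cons_zero,
      Nat.add_sub_cancel, hi, hi'] at hm ⊢
    refine Wp.ifz (T := 1) (T' := 0) ?_
    have hcw : chainWire n k (i + 1) = if j = 0 then n + k + 1 else i + 1 := by
      unfold chainWire
      split_ifs <;> omega
    have hcw' : chainWire n k i = i := if_pos (by omega)
    suffices h : Wp (emit [7, 9, 8, 11] ++ [.inc 8, .inc 9]) (2 + 2 * 4)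
        [len, n, k, D + 4 * (j + 1), 2, j, 0, chainWire n k (i + 1), i, n + i, 0, 1, n + k + 1] m'
        (fun l' m' => j ≤ k ∧
          (∃ x, l' = [len, n, k, D + 4 * j, 2, j, 0, x, i + 1, n + (i + 1), 0, 1, n + k + 1]) ∧
          Holds (D + 4 * j) (descWords n k (i + 1) ++
            ([0, chainWire n k 0, chainWire n k 0, chainWire n k 0] ++ L)) m') by
      by_cases hj0 : j = 0
      · rw [if_pos (by simpa using hj0)]
        refine Wp.copy (T := 0) (by simp) (Wp.nil (Wp.nil ?_))
        simpa [hcw, hj0] using h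
      · rw [if_neg (by simpa using hj0)]
        refine Wp.nil (Wp.nil ?_)
        simpa [hcw, hj0] using h
    refine Wp.emit [7, 9, 8, 11] (D + 4 * j) (by simp) (by simp) rfl hm fun m'' hm' =>
      Wp.inc (by simp) <| Wp.inc (by simp) <| Wp.nil ⟨hj.le, ⟨chainWire n k (i + 1), ?_⟩, ?_⟩
    · simp [add_assoc]
    · simpa [descWords, hcw'] using hm'
  · rintro l' m' ⟨-, ⟨x, rfl⟩, -⟩
    simp
  · rintro l' m' ⟨-, ⟨x, rfl⟩, hm⟩
    exact ⟨⟨x, by simp⟩, by simpa using hm⟩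

/-- Write the number of qubits and the accepting outcome, and clear the registers. -/
def writeOutcome : Program :=
  emit [11, 10, 11] ++ ([.dec 9] ++ ([.loop 9 (emit [10] ++ [.dec 9])] ++ ([.inc 12] ++
    (emit [12] ++ [.copy 1 10, .copy 2 10, .copy 3 10, .copy 4 10, .copy 5 10, .copy 6 10,
      .copy 7 10, .copy 8 10, .copy 9 10, .copy 11 10, .copy 12 10]))))

theorem writeOutcome_wp (len n k x : ℕ) (L : List ℕ) (hL : Holds (n + 1 + k + 3) L m) :
    Wp writeOutcome (1 + ((n + k) * (1 + 2 * 1 + 1) + 1 + (1 + (11 + 2 * 1))) + 2 * 3)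
      [len, n + 1, k, n + 1 + k + 3, 2, 0, 0, x, k, n + 1 + k, 0, 1, n + 1 + k + 1] m
      (fun l' m' => l' = [len, 0, 0, 0, 0, 0, 0, 0, 0, 0, 0, 0, 0] ∧
        Holds 0 ((n + 1 + k + 2) :: (List.replicate (n + k) 0 ++ ([1, 0, 1] ++ L))) m') := by
  unfold writeOutcome
  refine Wp.emit [11, 10, 11] (n + 1 + k) (by simp) (by simp) rfl hL fun m' hm' => ?_
  refine Wp.append (Wp.dec (by simp) <| Wp.nil ?_)
  simp only [List.set_cons_succ, List.set_cons_zero, List.getD_cons_succ, List.getD_cons_zero]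
  refine Wp.append (Wp.mono (Wp.loop (c := n + k) (fun j l' m' => j ≤ n + k ∧
    l' = [len, n + 1, k, 1 + j, 2, 0, 0, x, k, j, 0, 1, n + 1 + k + 1] ∧
      Holds (1 + j) (List.replicate (n + k - j) 0 ++ ([1, 0, 1] ++ L)) m') ?_ ?_ ?_) le_rfl ?_)
  · refine ⟨le_rfl, ?_, ?_⟩
    · simp only [List.cons.injEq, true_and, and_true]
      omega
    · rw [show 1 + (n + k) = n + 1 + k by ring]
      simpa using hm'
  · rintro j l' m' hj ⟨-, rfl, hm⟩
    refine ⟨by simp, Wp.emit [10] (1 + j) (by simp) (by simp) rfl hm fun m'' hm' =>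
      Wp.dec (by simp) <| Wp.nil ⟨hj.le, by simp, ?_⟩⟩
    have : n + k - j = n + k - (j + 1) + 1 := by omega
    rw [this, List.replicate_succ]
    simpa using hm'
  · rintro l' m' ⟨-, rfl, -⟩
    simp
  · rintro l' m' ⟨-, rfl, hm⟩
    refine Wp.append (Wp.inc (by simp) <| Wp.nil ?_)
    refine Wp.emit [12] 0 (by simp) (by simp) (by simp) hm fun m'' hm' => ?_
    refine Wp.copy (by simp) <| Wp.copy (by simp) <| Wp.copy (by simp) <| Wp.copy (by simp) <|
      Wp.copy (by simp) <| Wp.copy (by simp) <| Wp.copy (by simp) <| Wp.copy (by simp) <|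
      Wp.copy (by simp) <| Wp.copy (by simp) <| Wp.copy (by simp) <| Wp.nil ⟨by simp, ?_⟩
    simpa using hm'

theorem regs_zeros (x c : ℕ) :
    regs (x :: List.replicate c 0) = Function.update (fun _ => 0) 0 x := by
  funext i
  rcases i with _ | i
  · simp [regs]
  · by_cases h : i < c <;>
      simp [regs, List.getD_eq_getElem?_getD, h]

/-- Replace the description of a circuit by that of the associated HC1Q model. -/
def gapToHC1Q : Program := shiftGates ++ (writeAsc ++ (writeDesc ++ writeOutcome))

/-- The description of the HC1Q model associated with a circuit with description `w`. -/
def modelWords (n k : ℕ) (w : List ℕ) : List ℕ :=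
  (n + k + 2) :: (List.replicate (n - 1 + k) 0 ++ ([1, 0, 1] ++ (descWords n k k ++
    ([0, chainWire n k 0, chainWire n k 0, chainWire n k 0] ++ (ascWords n k 0 k ++ w)))))

/-- The end is literally a start configuration: register 0 holds the new length, the other registers
are cleared, and the memory is zero beyond the new words. Assumptions on runs of `A` thus apply
unchanged. -/
theorem gapToHC1Q_steps (A B : Program) (n k x : ℕ) (hn : 0 < n) (w : List ℕ) :
    ∃ t ≤ 60 * (n + k + w.length + 1),
      Steps ⟨gapToHC1Q ++ A, Function.update (start B (n :: k :: w)).reg 1 x,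
        (start B (n :: k :: w)).mem⟩ t (start A (modelWords n k w)) := by
  obtain ⟨n, rfl⟩ : ∃ i, n = i + 1 := ⟨n - 1, by omega⟩
  have hreg : Function.update (start B ((n + 1) :: k :: w)).reg 1 x =
      regs [w.length + 2, x, 0, 0, 0, 0, 0, 0, 0, 0, 0, 0, 0] := by
    have : (start B ((n + 1) :: k :: w)).reg = regs [w.length + 2, 0, 0, 0, 0, 0, 0, 0, 0, 0, 0, 0,
        0] := (regs_zeros (w.length + 2) 12).symm
    rw [this, update_regs (by simp)]
    rfl
  have hwp : Wp gapToHC1Q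
      (8 + ((n + 1) * 3 + 1 + (1 + (k * 15 + 1 + (6 + (w.length * (5 + 1) + 1)))))
      + ((2 + (k * 3 + 1 + (4 + (k * (2 + (1 + 2 * 8) + 1) + 1)))) +
      ((1 + (k * (3 + 2 + (2 + 2 * 4) + 1) + 1) + 2 * 4) +
      (1 + ((n + k) * (1 + 2 * 1 + 1) + 1 + (1 + (11 + 2 * 1))) + 2 * 3))))
      [w.length + 2, x, 0, 0, 0, 0, 0, 0, 0, 0, 0, 0, 0]
      (start B ((n + 1) :: k :: w)).mem (fun l' m' =>
        l' = [w.length + (n + 1) + 13 * k + 7, 0, 0, 0, 0, 0, 0, 0, 0, 0, 0, 0, 0] ∧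
        Holds 0 (modelWords (n + 1) k w) m') := by
    refine Wp.append (Wp.mono (shiftGates_wp (n + 1) k w x fun _ => rfl) le_rfl ?_)
    rintro _ m₁ ⟨⟨v, rfl⟩, h₁⟩
    -- The prefix splits into header and outcome, descending links, the middle NOT, and the
    -- ascending part.
    have e₁ : n + 1 + 13 * k + 7 = n + 1 + k + 3 + 4 * k + 4 + 8 * k := by ring
    rw [e₁] at h₁ ⊢
    refine Wp.append (Wp.mono (writeAsc_wp _ _ _ _ _ _ h₁) le_rfl ?_)
    rintro _ m₂ ⟨rfl, h₂⟩
    refine Wp.append (Wp.mono (writeDesc_wp _ _ _ _ _ h₂) le_rfl ?_)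
    rintro _ m₃ ⟨⟨y, rfl⟩, h₃⟩
    exact writeOutcome_wp _ _ _ _ _ h₃
  obtain ⟨t, ht, l', m', ⟨rfl, hm⟩, hs⟩ := hwp
  refine ⟨t, ht.trans (by ring_nf; omega), ?_⟩
  have hlen : (modelWords (n + 1) k w).length = w.length + (n + 1) + 13 * k + 7 := by
    have hd : ∀ i, (descWords (n + 1) k i).length = 4 * i := by
      intro i
      induction i with
      | zero => rfl
      | succ i ih => simp [descWords, ih]; ring
    simp [modelWords, ascWords, hd, List.length_flatMap]
    ring
  have hend : start A (modelWords (n + 1) k w) = ⟨A,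
      regs [w.length + (n + 1) + 13 * k + 7, 0, 0, 0, 0, 0, 0, 0, 0, 0, 0, 0, 0], m'⟩ := by
    unfold start
    rw [hlen]
    congr 1
    · exact (regs_zeros (w.length + (n + 1) + 13 * k + 7) 12).symm
    · funext i
      simpa using (hm i (Nat.zero_le _)).symm
  rw [hreg, hend]
  exact hs A

end RAM

/-! ### Transporting circuits along embeddings of wires -/

/-- Relabel the wires of a gate. -/
def Gate.map {m m' : ℕ} (f : Fin m ↪ Fin m') : Gate m → Gate m'
  | .not i => .not (f i)
  | .toffoli i j k hij hik hjk =>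
    .toffoli (f i) (f j) (f k) (f.injective.ne hij) (f.injective.ne hik) (f.injective.ne hjk)

theorem Gate.eval_map_comp {m m' : ℕ} (f : Fin m ↪ Fin m') (g : Gate m) (x : Fin m' → Bool) :
    (g.map f).eval x ∘ f = g.eval (x ∘ f) := by
  cases g <;> simp [Gate.map, Gate.eval, Function.update_comp_eq_of_injective _ f.injective]

theorem Gate.eval_map_of_notMem {m m' : ℕ} (f : Fin m ↪ Fin m') (g : Gate m) (x : Fin m' → Bool)
    {i : Fin m'} (hi : ∀ j, i ≠ f j) : (g.map f).eval x i = x i := by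
  cases g <;> simp [Gate.map, Gate.eval, Function.update_of_ne (hi _)]

namespace RevCircuit

/-- Relabel the wires of a circuit. -/
def map {m m' : ℕ} (f : Fin m ↪ Fin m') (C : RevCircuit m) : RevCircuit m' :=
  List.map (Gate.map f) C

theorem eval_cons {m : ℕ} (g : Gate m) (C : RevCircuit m) (x : Fin m → Bool) :
    eval (g :: C) x = eval C (g.eval x) := rfl

theorem eval_append {m : ℕ} (C D : RevCircuit m) (x : Fin m → Bool) :
    eval (C ++ D) x = eval D (eval C x) := List.foldl_append

theorem eval_map_comp {m m' : ℕ} (f : Fin m ↪ Fin m') (C : RevCircuit m) (x : Fin m' → Bool) :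
    eval (C.map f) x ∘ f = eval C (x ∘ f) := by
  induction C generalizing x with
  | nil => rfl
  | cons g C ih =>
    rw [eval_cons, ← Gate.eval_map_comp, ← ih]
    rfl

theorem eval_map_of_notMem {m m' : ℕ} (f : Fin m ↪ Fin m') (C : RevCircuit m)
    (x : Fin m' → Bool) {i : Fin m'} (hi : ∀ j, i ≠ f j) : eval (C.map f) x i = x i := by
  induction C generalizing x with
  | nil => rfl
  | cons g C ih =>
    rw [← Gate.eval_map_of_notMem f g x hi]
    exact ih _

theorem encode_append {m : ℕ} (C D : RevCircuit m) : encode (C ++ D) = encode C ++ encode D :=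
  List.flatMap_append

/-- This is why the program may copy the gates of the input verbatim. -/
theorem encode_map {m m' : ℕ} (f : Fin m ↪ Fin m') (hf : ∀ i, (f i : ℕ) = i) (C : RevCircuit m) :
    encode (C.map f) = encode C := by
  simp only [encode, map, List.flatMap_map]
  congr 1
  funext g
  cases g <;> simp [Gate.map, Gate.encode, hf]

theorem length_encode {m : ℕ} (C : RevCircuit m) : (encode C).length = 4 * C.length := by
  have : ∀ g : Gate m, g.encode.length = 4 := by rintro (_ | _) <;> rfl
  simp [encode, List.length_flatMap, this, mul_comm]

/-! ### A conjunction computed with dirty ancillas -/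

/-- A TOFFOLI gate adding to the target `a (j + 1)` the conjunction of `a j` and `z j`. -/
def link {m : ℕ} (a z : ℕ → Fin m) (j : ℕ) : Gate m :=
  if h : a j ≠ z j ∧ a j ≠ a (j + 1) ∧ z j ≠ a (j + 1) then
    .toffoli (a j) (z j) (a (j + 1)) h.1 h.2.1 h.2.2
  else .not (a j)

/-- A circuit that flips `a i`, for each `i ≤ j`, if all the controls `z l` with `l < i` are set,
and then negates the controls. -/
def chain {m : ℕ} (a z : ℕ → Fin m) : ℕ → RevCircuit m
  | 0 => [.not (a 0)]
  | j + 1 => link a z j :: (chain a z j ++ [link a z j, .not (z j)])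

theorem length_chain {m : ℕ} (a z : ℕ → Fin m) (j : ℕ) : (chain a z j).length = 3 * j + 1 := by
  induction j with
  | zero => rfl
  | succ j ih => simp [chain, ih]; ring

/-- The conjunction of the bits on the wires `z 0, …, z (j - 1)`. -/
def conj {m : ℕ} (z : ℕ → Fin m) (x : Fin m → Bool) : ℕ → Bool
  | 0 => true
  | j + 1 => conj z x j && x (z j)

theorem conj_eq_true_iff {m : ℕ} (z : ℕ → Fin m) (x : Fin m → Bool) (j : ℕ) :
    conj z x j = true ↔ ∀ l < j, x (z l) = true := by
  induction j with
  | zero => simp [conj]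
  | succ j ih =>
    rw [conj, Bool.and_eq_true, ih]
    exact (Nat.forall_lt_succ_right (p := fun l => x (z l) = true)).symm

theorem conj_congr {m : ℕ} {z : ℕ → Fin m} {x y : Fin m → Bool} {j : ℕ}
    (h : ∀ l < j, x (z l) = y (z l)) : conj z x j = conj z y j := by
  rw [Bool.eq_iff_iff, conj_eq_true_iff, conj_eq_true_iff]
  exact forall₂_congr fun l hl => by rw [h l hl]

/-- The two copies of link `j` surround a circuit that flips `a j` by the conjunction c of the
earlier controls. They add a_j z_j and (a_j ⊕ c) z_j to the next target, in total c z_j, so the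
unknown content of `a j` cancels. -/
theorem chain_spec {m k : ℕ} {a z : ℕ → Fin m} (ha : ∀ i ≤ k, ∀ j ≤ k, a i = a j → i = j)
    (hz : ∀ i < k, ∀ j < k, z i = z j → i = j) (haz : ∀ i ≤ k, ∀ j < k, a i ≠ z j) (j : ℕ)
    (hj : j ≤ k) (x : Fin m → Bool) :
    (∀ i ≤ j, eval (chain a z j) x (a i) = xor (x (a i)) (conj z x i)) ∧
      (∀ l < j, eval (chain a z j) x (z l) = !(x (z l))) ∧
      ∀ w, (∀ i ≤ j, w ≠ a i) → (∀ l < j, w ≠ z l) → eval (chain a z j) x w = x w := by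
  induction j generalizing x with
  | zero =>
    refine ⟨?_, by simp, ?_⟩
    · intro i hi
      obtain rfl : i = 0 := by omega
      simp [chain, eval, Gate.eval, conj]
    · intro w hw _
      simp [chain, eval, Gate.eval, Function.update_of_ne (hw 0 le_rfl)]
  | succ j ih =>
    have hlink : ∀ y, (link a z j).eval y =
        Function.update y (a (j + 1)) (xor (y (a (j + 1))) (y (a j) && y (z j))) := by
      intro y
      rw [link, dif_pos ⟨haz _ (by omega) _ (by omega),
        fun h => by have := ha _ (by omega) _ hj h; omega, (haz _ hj _ (by omega)).symm⟩]
      rfl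
    have haa : ∀ i ≤ j, a i ≠ a (j + 1) := fun i hi h => by
      have := ha _ (by omega) _ hj h; omega
    have hza : ∀ l < j + 1, z l ≠ a (j + 1) := fun l hl => (haz _ hj _ (by omega)).symm
    have hzz : ∀ l < j, z l ≠ z j := fun l hl h => by
      have := hz _ (by omega) _ (by omega) h; omega
    obtain ⟨x₁, hx₁⟩ : ∃ y, y = (link a z j).eval x := ⟨_, rfl⟩
    obtain ⟨x₂, hx₂⟩ : ∃ y, y = eval (chain a z j) x₁ := ⟨_, rfl⟩
    obtain ⟨x₃, hx₃⟩ : ∃ y, y = (link a z j).eval x₂ := ⟨_, rfl⟩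
    have hev : eval (chain a z (j + 1)) x = Function.update x₃ (z j) (!(x₃ (z j))) := by
      rw [chain, eval_cons, eval_append, ← hx₁, ← hx₂, eval_cons, ← hx₃]
      rfl
    obtain ⟨h₁, h₂, h₃⟩ := ih (by omega) x₁
    rw [← hx₂] at h₁ h₂ h₃
    rw [hlink] at hx₁ hx₃
    have e₁ : ∀ w, w ≠ a (j + 1) → x₁ w = x w := fun w hw => by
      rw [hx₁, Function.update_of_ne hw]
    have e₃ : ∀ w, w ≠ a (j + 1) → x₃ w = x₂ w := fun w hw => by
      rw [hx₃, Function.update_of_ne hw]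
    have hconj : ∀ i ≤ j, conj z x₁ i = conj z x i := fun i hi =>
      conj_congr fun l hl => e₁ _ (hza l (by omega))
    have hzj : x₂ (z j) = x (z j) := by
      rw [h₃ _ (fun i hi => (haz i (by omega) j (by omega)).symm) (fun l hl => (hzz l hl).symm),
        e₁ _ (hza j (by omega))]
    rw [hev]
    refine ⟨fun i hi => ?_, fun l hl => ?_, fun w hwa hwz => ?_⟩
    · rw [Function.update_of_ne (haz i (by omega) j (by omega))]
      rcases Nat.lt_or_eq_of_le hi with hi | rfl
      · rw [e₃ _ (haa i (by omega)), h₁ i (by omega), e₁ _ (haa i (by omega)),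
          hconj i (by omega)]
      · rw [hx₃, Function.update_self, hzj, h₁ j le_rfl, hconj j le_rfl, e₁ _ (haa j le_rfl),
          h₃ _ (fun i hi => (haa i hi).symm) (fun l hl => (hza l (by omega)).symm), hx₁,
          Function.update_self, conj]
        generalize x (a (j + 1)) = b₁, x (a j) = b₂, x (z j) = b₃, conj z x j = b₄
        revert b₁ b₂ b₃ b₄
        decide
    · rcases Nat.lt_or_eq_of_le (Nat.lt_succ_iff.1 hl) with hl | rfl
      · rw [Function.update_of_ne (hzz l hl), e₃ _ (hza l (by omega)), h₂ l hl,
          e₁ _ (hza l (by omega))]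
      · rw [Function.update_self, e₃ _ (hza l (by omega)), hzj]
    · rw [Function.update_of_ne (hwz j (by omega)), e₃ _ (hwa _ le_rfl),
        h₃ w (fun i hi => hwa i (by omega)) (fun l hl => hwz l (by omega)), e₁ _ (hwa _ le_rfl)]

end RevCircuit

/-! ### The HC1Q model associated with a circuit -/

/-- The wires of the chain of targets. -/
def targetWire (n k j : ℕ) : Fin (n + k + 2) := Fin.ofNat (n + k + 2) (RAM.chainWire n k j)

/-- The ancilla wires. -/
def ancillaWire (n k j : ℕ) : Fin (n + k + 2) := Fin.ofNat (n + k + 2) (n + j)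

theorem val_targetWire (n k j : ℕ) :
    (targetWire n k j : ℕ) = RAM.chainWire n k j := by
  refine Nat.mod_eq_of_lt ?_
  unfold RAM.chainWire
  split_ifs <;> omega

theorem val_ancillaWire {n k j : ℕ} (hj : j < k) : (ancillaWire n k j : ℕ) = n + j :=
  Nat.mod_eq_of_lt (by omega)

theorem targetWire_injective {n k : ℕ} :
    ∀ i ≤ k, ∀ j ≤ k, targetWire n k i = targetWire n k j → i = j := by
  intro i hi j hj h
  have := congrArg Fin.val h
  rw [val_targetWire, val_targetWire, RAM.chainWire, RAM.chainWire] at this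
  split_ifs at this <;> omega

theorem ancillaWire_injective {n k : ℕ} :
    ∀ i < k, ∀ j < k, ancillaWire n k i = ancillaWire n k j → i = j := by
  intro i hi j hj h
  have := congrArg Fin.val h
  rw [val_ancillaWire hi, val_ancillaWire hj] at this
  omega

/-- Here k ≤ n is essential: the k dirty targets must fit among the input wires. -/
theorem targetWire_ne_ancillaWire {n k : ℕ} (hk : k ≤ n) :
    ∀ i ≤ k, ∀ j < k, targetWire n k i ≠ ancillaWire n k j := by
  intro i hi j hj h
  have := congrArg Fin.val h
  rw [val_targetWire, val_ancillaWire hj, RAM.chainWire] at this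
  split_ifs at this <;> omega

/-- Unrolling the nested recursion gives the links in descending order, the innermost NOT, and the
links in ascending order, each followed by the negation of its control. -/
theorem encode_chain {n k : ℕ} (hk : k ≤ n) (i : ℕ) (hi : i ≤ k) :
    RevCircuit.encode (RevCircuit.chain (targetWire n k) (ancillaWire n k) i) =
      RAM.descWords n k i ++ ([0, RAM.chainWire n k 0, RAM.chainWire n k 0, RAM.chainWire n k 0] ++
        RAM.ascWords n k 0 i) := by
  induction i with
  | zero => simp [RevCircuit.chain, RevCircuit.encode, Gate.encode, RAM.descWords, RAM.ascWords,
      val_targetWire]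
  | succ i ih =>
    have hlink : (RevCircuit.link (targetWire n k) (ancillaWire n k) i).encode =
        [1, RAM.chainWire n k i, n + i, RAM.chainWire n k (i + 1)] := by
      rw [RevCircuit.link, dif_pos ⟨targetWire_ne_ancillaWire hk _ (by omega) _ hi,
        fun h => by have := targetWire_injective _ (by omega) _ hi h; omega,
        (targetWire_ne_ancillaWire hk _ hi _ hi).symm⟩]
      simp [Gate.encode, val_targetWire, val_ancillaWire (Nat.lt_of_succ_le hi)]
    have hc : RevCircuit.encode
        (RevCircuit.chain (targetWire n k) (ancillaWire n k) (i + 1)) =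
        (RevCircuit.link (targetWire n k) (ancillaWire n k) i).encode ++
        (RevCircuit.encode (RevCircuit.chain (targetWire n k) (ancillaWire n k) i) ++
        ((RevCircuit.link (targetWire n k) (ancillaWire n k) i).encode ++
          (Gate.not (ancillaWire n k i)).encode)) := by
      simp [RevCircuit.chain, RevCircuit.encode]
    have hasc : RAM.ascWords n k 0 (i + 1) = RAM.ascWords n k 0 i ++
        [1, RAM.chainWire n k i, n + i, RAM.chainWire n k (i + 1), 0, n + i, n + i, n + i] := by
      simp [RAM.ascWords, List.range'_concat]
    rw [hc, hlink, ih (by omega), hasc, RAM.descWords]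
    simp [Gate.encode, val_ancillaWire (Nat.lt_of_succ_le hi)]

/-- The outcome: `1` on the last wire of the given circuit and on the last qubit, `0` elsewhere. -/
def gapOutcome (n k : ℕ) (i : Fin (n + k + 2)) : Bool :=
  decide ((i : ℕ) + 1 = n + k ∨ (i : ℕ) = n + k + 1)

/-- The HC1Q model associated with a circuit. -/
def gapModel (n k : ℕ) (C : RevCircuit (n + k)) : HC1Q (n + k + 2) where
  circuit := RevCircuit.chain (targetWire n k) (ancillaWire n k) k ++ C.map (Fin.castAddEmb 2)
  outcome i := some (gapOutcome n k i)

theorem length_gapModel_circuit (n k : ℕ) (C : RevCircuit (n + k)) :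
    (gapModel n k C).circuit.length = 3 * k + 1 + C.length := by
  simp [gapModel, RevCircuit.length_chain, RevCircuit.map]

theorem encode_gapModel {n k : ℕ} (hn : 0 < n) (hk : k ≤ n) (C : RevCircuit (n + k)) :
    (gapModel n k C).encode = RAM.modelWords n k (RevCircuit.encode C) := by
  obtain ⟨n, rfl⟩ : ∃ i, n = i + 1 := ⟨n - 1, by omega⟩
  have hout : List.ofFn (fun i => ((gapModel (n + 1) k C).outcome i).elim 2 Bool.toNat) =
      List.replicate (n + k) 0 ++ [1, 0, 1] := by
    apply List.ext_getElem
    · simp; ring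
    · intro i h1 h2
      simp only [gapModel, gapOutcome, Option.elim_some, List.getElem_ofFn]
      by_cases hi : i < n + k
      · rw [List.getElem_append_left (by simpa using hi), List.getElem_replicate]
        have : ¬ (i + 1 = n + 1 + k ∨ i = n + 1 + k + 1) := by omega
        simp [this]
      · obtain ⟨j, rfl⟩ : ∃ j, i = n + k + j := ⟨i - (n + k), by omega⟩
        have hj : j < 3 := by simp at h2; omega
        rw [List.getElem_append_right (by simp)]
        interval_cases j <;> simp <;> omega
  rw [HC1Q.encode, hout]
  simp only [gapModel, RevCircuit.encode_append, encode_chain hk k le_rfl,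
    RevCircuit.encode_map (Fin.castAddEmb 2) (fun i => rfl), RAM.modelWords, List.append_assoc,
    Nat.add_sub_cancel]

/-! ### The acceptance probability -/

theorem hadamardLayer_succ (m : ℕ) (x y : Fin (m + 1) → Bool) :
    hadamardLayer (m + 1) x y = (1 / (Real.sqrt 2 : ℂ)) ^ m *
      ((∏ i : Fin m, if x i.castSucc && y i.castSucc then -1 else 1) *
        if x (Fin.last m) = y (Fin.last m) then 1 else 0) := by
  unfold hadamardLayer
  rw [Fin.prod_univ_castSucc, ← mul_assoc]
  congr 1
  · have : ∀ i : Fin m, (i : ℕ) + 1 ≠ m + 1 := fun i => by omega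
    simp only [Fin.val_castSucc, this, if_false, hadamard, Finset.prod_mul_distrib,
      Finset.prod_const, Finset.card_univ, Fintype.card_fin]
  · simp

theorem HC1Q.finalState_eq {N : ℕ} (M : HC1Q N) (z : Fin N → Bool) :
    M.finalState z = ∑ u, hadamardLayer N z (M.circuit.eval u) *
      hadamardLayer N u (fun _ => false) := by
  rw [HC1Q.finalState, Matrix.mulVec_single_one, Matrix.col_apply, Matrix.mul_apply]
  refine Finset.sum_congr rfl fun u _ => ?_
  rw [Matrix.mul_apply]
  simp [RevCircuit.toMatrix]

/-- When every qubit is measured, a single amplitude survives. -/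
theorem HC1Q.acceptProb_eq {N : ℕ} (M : HC1Q N) (z : Fin N → Bool)
    (hz : ∀ i, M.outcome i = some (z i)) : M.acceptProb = ‖M.finalState z‖ ^ 2 := by
  unfold HC1Q.acceptProb
  have : ∀ y : Fin N → Bool, (∀ (i : Fin N) (b : Bool), M.outcome i = some b → y i = b) ↔ y = z := by
    intro y
    simp only [hz, Option.some.injEq, forall_eq']
    exact funext_iff.symm
  simp only [this, Finset.sum_ite_eq', Finset.mem_univ, if_true]

/-- Negate the first `k` bits. -/
def flipFirst (n k : ℕ) (x : Fin n → Bool) : Fin n → Bool :=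
  fun i => if (i : ℕ) < k then !(x i) else x i

theorem flipFirst_involutive (n k : ℕ) : Function.Involutive (flipFirst n k) := by
  intro x
  funext i
  by_cases h : (i : ℕ) < k <;> simp [flipFirst, h]

theorem eval_gapModel_last {n k : ℕ} (hk : k ≤ n) (C : RevCircuit (n + k))
    (u : Fin (n + k + 2) → Bool) :
    RevCircuit.eval (gapModel n k C).circuit u (Fin.last (n + k + 1)) =
      xor (u (Fin.last (n + k + 1))) (RevCircuit.conj (ancillaWire n k) u k) := by
  have hlast : Fin.last (n + k + 1) = targetWire n k k := by
    apply Fin.ext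
    simp [val_targetWire, RAM.chainWire]
  rw [gapModel, RevCircuit.eval_append, RevCircuit.eval_map_of_notMem, hlast]
  · exact (RevCircuit.chain_spec targetWire_injective ancillaWire_injective
      (targetWire_ne_ancillaWire hk) k le_rfl u).1 k le_rfl
  · intro j h
    have := congrArg Fin.val h
    simp at this
    omega

/-- With all ancillas 1 every partial conjunction holds: each dirty input wire is flipped and the
negated ancillas are 0, as C expects. -/
theorem eval_gapModel_castAdd {n k : ℕ} (hk : k ≤ n) (C : RevCircuit (n + k))
    (u : Fin (n + k + 2) → Bool) (hu : ∀ l < k, u (ancillaWire n k l) = true) :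
    RevCircuit.eval (gapModel n k C).circuit u ∘ Fin.castAddEmb 2 =
      RevCircuit.eval C (Fin.append
        (flipFirst n k fun i => u (Fin.castAdd 2 (Fin.castAdd k i))) (fun _ => false)) := by
  obtain ⟨h₁, h₂, h₃⟩ := RevCircuit.chain_spec targetWire_injective ancillaWire_injective
      (targetWire_ne_ancillaWire hk) k le_rfl u
  rw [gapModel, RevCircuit.eval_append, RevCircuit.eval_map_comp]
  congr 1
  funext i
  refine Fin.addCases (fun i => ?_) (fun l => ?_) i
  · rw [Fin.append_left, flipFirst, Function.comp_apply]
    by_cases hi : (i : ℕ) < k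
    · have : Fin.castAdd 2 (Fin.castAdd k i) = targetWire n k i := by
        apply Fin.ext
        simp [val_targetWire, RAM.chainWire, hi]
      rw [if_pos hi, Fin.castAddEmb_apply, this, h₁ _ hi.le,
        (RevCircuit.conj_eq_true_iff _ _ _).2 fun l hl => hu l (hl.trans hi), Bool.xor_true]
    · rw [if_neg hi]
      refine h₃ _ (fun j hj h => ?_) (fun j hj h => ?_)
      · have := congrArg Fin.val h
        rw [val_targetWire, RAM.chainWire] at this
        simp at this
        split_ifs at this <;> omega
      · have := congrArg Fin.val h
        rw [val_ancillaWire hj] at this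
        simp at this
        omega
  · have : Fin.castAdd 2 (Fin.natAdd n l) = ancillaWire n k l := by
      apply Fin.ext
      simp [val_ancillaWire l.2]
    rw [Fin.append_right, Function.comp_apply, Fin.castAddEmb_apply, this, h₂ _ l.2, hu _ l.2]
    rfl

/-- Splitting a bit string into the input, the ancillas and two further bits. -/
theorem sum_bits {n k : ℕ} (F : (Fin (n + k + 2) → Bool) → ℂ) :
    ∑ u, F u = ∑ x : Fin n → Bool, ∑ z : Fin k → Bool, ∑ y : Bool, ∑ t : Bool,
      F (Fin.snoc (Fin.snoc (Fin.append x z) y : Fin (n + k + 1) → Bool) t) := by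
  rw [← (Fin.snocEquiv fun _ => Bool).sum_comp, Fintype.sum_prod_type_right,
    ← (Fin.snocEquiv fun _ => Bool).sum_comp, Fintype.sum_prod_type_right,
    ← (Fin.appendEquiv n k).sum_comp, Fintype.sum_prod_type]
  rfl

/-- Only terms with last bit 0 before the circuit and 1 after it contribute, which forces all
ancillas to be 1. Wire n + k is idle, and summing over its two values gives the factor 2. -/
theorem finalState_gapModel {n k : ℕ} (hn : 0 < n) (hk : k ≤ n) (C : RevCircuit (n + k)) :
    (gapModel n k C).finalState (gapOutcome n k) =
      (1 / (Real.sqrt 2 : ℂ)) ^ (n + k + 1) * (1 / (Real.sqrt 2 : ℂ)) ^ (n + k + 1) *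
        (2 * (gap n k C : ℂ)) := by
  have hpos : 0 < n + k := by omega
  have hz : ∀ v : Fin (n + k + 2) → Bool, hadamardLayer (n + k + 2) (gapOutcome n k) v =
      (1 / (Real.sqrt 2 : ℂ)) ^ (n + k + 1) *
        ((-1) ^ (lastBit (v ∘ Fin.castAddEmb 2)).toNat *
          if v (Fin.last (n + k + 1)) = true then 1 else 0) := by
    intro v
    rw [hadamardLayer_succ]
    congr 2
    · rw [Finset.prod_eq_single (⟨n + k - 1, by omega⟩ : Fin (n + k + 1))]
      · have h1 : gapOutcome n k (Fin.castSucc ⟨n + k - 1, by omega⟩) = true := by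
          simp [gapOutcome]
          omega
        rw [h1, lastBit, dif_pos hpos, Bool.true_and]
        have h2 : (v ∘ Fin.castAddEmb 2) ⟨n + k - 1, Nat.sub_lt hpos Nat.one_pos⟩ =
            v (Fin.castSucc ⟨n + k - 1, by omega⟩) := rfl
        rw [h2]
        cases v (Fin.castSucc ⟨n + k - 1, by omega⟩) <;> simp
      · intro i _ hi
        have h1 : gapOutcome n k (Fin.castSucc i) = false := by
          have : (i : ℕ) ≠ n + k - 1 := fun h => hi (Fin.ext h)
          have := i.2
          simp [gapOutcome]
          omega
        simp [h1]
      · simp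
    · have h1 : gapOutcome n k (Fin.last (n + k + 1)) = true := by simp [gapOutcome]
      rw [h1]
      simp only [eq_comm]
  have h0 : ∀ u : Fin (n + k + 2) → Bool, hadamardLayer (n + k + 2) u (fun _ => false) =
      (1 / (Real.sqrt 2 : ℂ)) ^ (n + k + 1) *
        if u (Fin.last (n + k + 1)) = false then 1 else 0 := by
    intro u
    rw [hadamardLayer_succ]
    simp
  have hu : ∀ (x : Fin n → Bool) (z : Fin k → Bool) (y t : Bool), ∀ l (hl : l < k),
      (Fin.snoc (Fin.snoc (Fin.append x z) y : Fin (n + k + 1) → Bool) t : Fin (n + k + 2) → Bool)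
        (ancillaWire n k l) = z ⟨l, hl⟩ := by
    intro x z y t l hl
    have : ancillaWire n k l = Fin.castSucc (Fin.castSucc (Fin.natAdd n ⟨l, hl⟩)) := by
      apply Fin.ext
      simp [val_ancillaWire hl]
    rw [this, Fin.snoc_castSucc (α := fun _ => Bool), Fin.snoc_castSucc (α := fun _ => Bool),
      Fin.append_right]
  have hux : ∀ (x : Fin n → Bool) (z : Fin k → Bool) (y t : Bool),
      (fun i => (Fin.snoc (Fin.snoc (Fin.append x z) y : Fin (n + k + 1) → Bool) t :
        Fin (n + k + 2) → Bool) (Fin.castAdd 2 (Fin.castAdd k i))) = x := by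
    intro x z y t
    funext i
    have : Fin.castAdd 2 (Fin.castAdd k i) = Fin.castSucc (Fin.castSucc (Fin.castAdd k i)) := rfl
    rw [this, Fin.snoc_castSucc (α := fun _ => Bool), Fin.snoc_castSucc (α := fun _ => Bool),
      Fin.append_left]
  have hterm : ∀ (x : Fin n → Bool) (z : Fin k → Bool) (y t : Bool),
      hadamardLayer (n + k + 2) (gapOutcome n k) ((gapModel n k C).circuit.eval
        (Fin.snoc (Fin.snoc (Fin.append x z) y : Fin (n + k + 1) → Bool) t)) *
      hadamardLayer (n + k + 2)
        (Fin.snoc (Fin.snoc (Fin.append x z) y : Fin (n + k + 1) → Bool) t) (fun _ => false) =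
      if z = fun _ => true then (if t = false then
        (1 / (Real.sqrt 2 : ℂ)) ^ (n + k + 1) * (1 / (Real.sqrt 2 : ℂ)) ^ (n + k + 1) *
        (-1) ^ (lastBit (RevCircuit.eval C
          (Fin.append (flipFirst n k x) (fun _ => false)))).toNat else 0) else 0 := by
    intro x z y t
    rw [hz, h0, eval_gapModel_last hk, Fin.snoc_last]
    cases t
    · by_cases hzt : z = fun _ => true
      · have hall : ∀ l < k, (Fin.snoc (Fin.snoc (Fin.append x z) y : Fin (n + k + 1) → Bool) false :
            Fin (n + k + 2) → Bool) (ancillaWire n k l) = true := fun l hl => by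
          rw [hu x z y false l hl, hzt]
        rw [(RevCircuit.conj_eq_true_iff _ _ _).2 hall, eval_gapModel_castAdd hk _ _ hall, hux]
        simp [hzt]
        ring
      · have hconj : RevCircuit.conj (ancillaWire n k)
            (Fin.snoc (Fin.snoc (Fin.append x z) y : Fin (n + k + 1) → Bool) false) k = false := by
          rw [← Bool.not_eq_true, RevCircuit.conj_eq_true_iff]
          intro h
          refine hzt (funext fun l => ?_)
          rw [← h l l.2, hu x z y false l l.2]
        simp [hconj, hzt]
    · simp
  rw [HC1Q.finalState_eq, sum_bits]
  simp only [hterm, Fintype.sum_bool, Finset.sum_ite_irrel, Finset.sum_const_zero,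
    Finset.sum_ite_eq', Finset.mem_univ, if_true]
  -- The flips left on the dirty wires are removed by reindexing the sum over inputs.
  have hflip := Equiv.sum_comp (flipFirst_involutive n k).toPerm (fun x => (-1 : ℂ) ^
    (lastBit (RevCircuit.eval C (Fin.append x (fun _ : Fin k => false)))).toNat)
  have hgap : (gap n k C : ℂ) = ∑ x : Fin n → Bool, (-1 : ℂ) ^
      (lastBit (RevCircuit.eval C (Fin.append x (fun _ : Fin k => false)))).toNat := by
    simp [gap]
  rw [hgap, ← hflip]
  simp only [← two_mul, Finset.mul_sum, Function.Involutive.coe_toPerm]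
  exact Finset.sum_congr rfl fun x _ => by ring

theorem acceptProb_gapModel_ne_zero_iff {n k : ℕ} (hn : 0 < n) (hk : k ≤ n)
    (C : RevCircuit (n + k)) : (gapModel n k C).acceptProb ≠ 0 ↔ gap n k C ≠ 0 := by
  rw [HC1Q.acceptProb_eq _ (gapOutcome n k) (fun _ => rfl), finalState_gapModel hn hk]
  simp

/-! ### Descriptions of circuits -/

theorem Gate.encode_injective {m : ℕ} : Function.Injective (Gate.encode (m := m)) := by
  rintro (i | ⟨i, j, k⟩) (i' | ⟨i', j', k'⟩) h <;>
    simp only [Gate.encode, List.cons.injEq, and_true, true_and, zero_ne_one, one_ne_zero,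
      false_and] at h
  · rw [Fin.ext h.1]
  · obtain ⟨h1, h2, h3⟩ := h
    obtain rfl := Fin.ext h1
    obtain rfl := Fin.ext h2
    obtain rfl := Fin.ext h3
    rfl

theorem Gate.length_encode {m : ℕ} (g : Gate m) : g.encode.length = 4 := by
  cases g <;> rfl

/-- Every gate takes four words, so the description parses uniquely; the table can therefore be
indexed by descriptions. -/
theorem RevCircuit.encode_injective {m : ℕ} : Function.Injective (RevCircuit.encode (m := m)) := by
  intro C D h
  induction C generalizing D with
  | nil =>
    have := congrArg List.length h
    rw [length_encode, length_encode] at this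
    exact (List.length_eq_zero_iff.1 (by simpa using this.symm)).symm
  | cons g C ih =>
    cases D with
    | nil =>
      have := congrArg List.length h
      rw [length_encode, length_encode] at this
      simp at this
    | cons g' D =>
      obtain ⟨h1, h2⟩ := List.append_inj (s₁ := g.encode) (s₂ := g'.encode) h
        (by rw [Gate.length_encode, Gate.length_encode])
      rw [Gate.encode_injective h1, ih h2]

theorem RevCircuit.le_of_mem_encode {m : ℕ} {C : RevCircuit m} {x : ℕ} (hx : x ∈ C.encode) :
    x ≤ m + 1 := by
  obtain ⟨g, -, hg⟩ := List.mem_flatMap.1 hx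
  cases g <;> simp only [Gate.encode, List.mem_cons, List.not_mem_nil, or_false] at hg <;> omega

theorem length_gapInput (n k : ℕ) (C : RevCircuit (n + k)) :
    (gapInput n k C).length = 4 * C.length + 2 := by
  simp [gapInput, RevCircuit.length_encode]

theorem le_of_mem_gapInput {n k : ℕ} {C : RevCircuit (n + k)} {x : ℕ}
    (hx : x ∈ gapInput n k C) : x ≤ n + k + 1 := by
  simp only [gapInput, List.mem_cons] at hx
  rcases hx with rfl | rfl | hx
  · omega
  · omega
  · exact RevCircuit.le_of_mem_encode hx

open Classical in
/-- The language of the descriptions of circuits with nonzero gap. -/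
noncomputable def gapLanguage (ξ : ℕ → ℕ) (w : List ℕ) : Bool :=
  decide (∃ (n : ℕ) (C : RevCircuit (n + ξ n)), w = gapInput n (ξ n) C ∧ gap n (ξ n) C ≠ 0)

theorem gapLanguage_gapInput (ξ : ℕ → ℕ) (n : ℕ) (C : RevCircuit (n + ξ n)) :
    gapLanguage ξ (gapInput n (ξ n) C) = true ↔ gap n (ξ n) C ≠ 0 := by
  simp only [gapLanguage, decide_eq_true_eq]
  refine ⟨?_, fun h => ⟨n, C, rfl, h⟩⟩
  rintro ⟨n', C', h, hgap⟩
  simp only [gapInput, List.cons.injEq] at h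
  obtain ⟨rfl, -, h⟩ := h
  rwa [RevCircuit.encode_injective h]

/-! ### Growth -/

theorem polynomial_isLittleO_pow (P : Polynomial ℕ) {r : ℝ} (hr : 1 < r) :
    (fun n : ℕ => ((P.eval n : ℕ) : ℝ)) =o[atTop] fun n : ℕ => r ^ n := by
  have : (fun n : ℕ => ((P.eval n : ℕ) : ℝ)) =
      fun n : ℕ => ∑ i ∈ Finset.range (P.natDegree + 1), (P.coeff i : ℝ) * (n : ℝ) ^ i := by
    funext n
    rw [Polynomial.eval_eq_sum_range]
    push_cast
    rfl
  rw [this]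
  refine IsLittleO.fun_sum fun i _ => ?_
  exact (isLittleO_pow_const_const_pow_of_one_lt (R := ℝ) i hr).const_mul_left _

/-- Each summand is o(2^(cn)), hence eventually at most half of it. -/
theorem eventually_polynomial_add_rpow_le (P : Polynomial ℕ) {c d : ℝ} (hc : 0 < c) (hdc : d < c) :
    ∀ᶠ n : ℕ in atTop,
      ((P.eval n : ℕ) : ℝ) + (2 : ℝ) ^ (d * (n : ℝ)) ≤ (2 : ℝ) ^ (c * (n : ℝ)) := by
  have h1 := (polynomial_isLittleO_pow P (r := (2 : ℝ) ^ c)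
    (Real.one_lt_rpow one_lt_two hc)).bound (c := 1 / 2) (by norm_num)
  have h2 := (isLittleO_pow_pow_of_lt_left (r₁ := (2 : ℝ) ^ d) (r₂ := (2 : ℝ) ^ c) (by positivity)
    (Real.rpow_lt_rpow_of_exponent_lt one_lt_two hdc)).bound (c := 1 / 2) (by norm_num)
  filter_upwards [h1, h2] with n h1 h2
  rw [Real.rpow_mul zero_le_two, Real.rpow_mul zero_le_two, Real.rpow_natCast, Real.rpow_natCast]
  rw [Real.norm_of_nonneg (by positivity), Real.norm_of_nonneg (by positivity)] at h1 h2
  linarith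

/-! ### Deciding gaps with a sampling algorithm -/

theorem HC1Q.acceptProb_nonneg {N : ℕ} (M : HC1Q N) : 0 ≤ M.acceptProb :=
  Finset.sum_nonneg fun z _ => by split_ifs <;> positivity

theorem RAM.haltsIn_and_acceptsIn_iff_of_samples {n k : ℕ} (hn : 0 < n) (hk : k ≤ n)
    (C : RevCircuit (n + k)) {A : Program} {T ε : ℝ} (hε : ε < 1)
    (hA : Samples A (gapModel n k C).encode T ε (gapModel n k C).acceptProb)
    (f : List ℕ → Bool) (b l m : ℕ) (hm : m ≤ n) {t : ℕ}
    (ht : 2 * m + 1 + 60 * (n + k + 4 * C.length + 1) + ⌊T⌋₊ ≤ t) :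
    HaltsIn (start (withTable f b l m (gapToHC1Q ++ A)) (gapInput n k C)) t ∧
      (AcceptsIn (start (withTable f b l m (gapToHC1Q ++ A)) (gapInput n k C)) t ↔
        gap n k C ≠ 0) := by
  obtain ⟨t₁, ht₁, hs₁⟩ := withTable_start_steps f b l m (gapToHC1Q ++ A) (gapInput n k C)
  have h0 : (gapInput n k C).getD 0 0 = n := rfl
  rw [h0, if_neg (by omega)] at hs₁
  obtain ⟨t₂, ht₂, hs₂⟩ := gapToHC1Q_steps A (gapToHC1Q ++ A) n k (n - m) hn C.encode
  rw [← encode_gapModel hn hk] at hs₂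
  rw [RevCircuit.length_encode] at ht₂
  have hs := hs₁.trans hs₂
  have hh := (runsInTime_iff _ _ _).1 hA.1
  have hle : t₁ + t₂ + ⌊T⌋₊ ≤ t := by omega
  refine ⟨(hs.haltsIn hh).mono hle, ?_⟩
  rw [(hs.haltsIn hh).acceptsIn_iff hle, hs.acceptsIn_iff, ← nAccepts_iff,
    hA.nAccepts_iff (HC1Q.acceptProb_nonneg _) hε, acceptProb_gapModel_ne_zero_iff hn hk]

theorem theorem5 (ξ : ℕ → ℕ)
    (hξ : (fun n : ℕ => (ξ n : ℝ)) =o[atTop] (fun n : ℕ => (n : ℝ)))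
    (hconj : ReversibleGapConjecture ξ) :
    ∃ q : Polynomial ℕ, ∀ a : ℝ, 0 < a → ∀ A : RAM.Program,
      ∃ᶠ N : ℕ in atTop, ∃ n : ℕ, N = n + ξ n + 2 ∧
        ∃ M : HC1Q N, M.circuit.length ≤ q.eval N ∧
          ∀ ε : ℝ, ε < 1 →
            ¬ RAM.Samples A M.encode
              ((2 : ℝ) ^ ((1 - a) * ((N : ℝ) - (ξ n : ℝ) - 2))) ε M.acceptProb := by
  obtain ⟨p, hp⟩ := hconj
  -- The model has 3ξ(n) + 1 gates besides those of C, and ξ(n) ≤ N.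
  refine ⟨p + 3 * Polynomial.X + 1, fun a ha A => ?_⟩
  by_contra hfreq
  rw [not_frequently, eventually_atTop] at hfreq
  obtain ⟨N₀, hN₀⟩ := hfreq
  obtain ⟨n₁, hn₁⟩ : ∃ n₁, ∀ n ≥ n₁, ξ n ≤ n := by
    obtain ⟨n₁, h⟩ := eventually_atTop.1 (hξ.bound (c := 1) one_pos)
    exact ⟨n₁, fun n hn => by simpa using h n hn⟩
  -- From `m` on, the sampler works, ξ(n) ≤ n, and n > 0; smaller n go to the table.
  obtain ⟨m, hm⟩ : ∃ m, m = max (max N₀ n₁) 1 := ⟨_, rfl⟩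
  have hsample : ∀ n, m ≤ n → ∀ C : RevCircuit (n + ξ n), C.length ≤ p.eval n → ∃ ε < (1 : ℝ),
      RAM.Samples A (gapModel n (ξ n) C).encode ((2 : ℝ) ^ ((1 - a) * (n : ℝ))) ε
        (gapModel n (ξ n) C).acceptProb := by
    intro n hn C hC
    by_contra! hcon
    refine hN₀ (n + ξ n + 2) (by omega) ⟨n, rfl, gapModel n (ξ n) C, ?_, ?_⟩
    · have hmono : p.eval n ≤ p.eval (n + ξ n + 2) := by
        rw [Polynomial.eval_eq_sum_range, Polynomial.eval_eq_sum_range]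
        exact Finset.sum_le_sum fun i _ =>
          Nat.mul_le_mul_left _ (Nat.pow_le_pow_left (by omega) i)
      rw [length_gapModel_circuit]
      simp only [Polynomial.eval_add, Polynomial.eval_mul, Polynomial.eval_X, Polynomial.eval_one,
        Polynomial.eval_ofNat]
      omega
    · intro ε hε
      have : (((n + ξ n + 2 : ℕ) : ℝ) - (ξ n : ℝ) - 2) = (n : ℝ) := by
        push_cast
        ring
      rw [this]
      exact hcon ε hε
  -- Sums serve as crude common bounds on the words and lengths of the inputs in the table.
  obtain ⟨b, hb⟩ : ∃ b, ∀ n < m, n + ξ n + 1 ≤ b :=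
    ⟨∑ n ∈ Finset.range m, (n + ξ n + 1), fun n hn => Finset.single_le_sum
      (f := fun n => n + ξ n + 1) (fun _ _ => Nat.zero_le _) (Finset.mem_range.2 hn)⟩
  obtain ⟨l, hl⟩ : ∃ l, ∀ n < m, 4 * p.eval n + 2 ≤ l :=
    ⟨∑ n ∈ Finset.range m, (4 * p.eval n + 2), fun n hn => Finset.single_le_sum
      (f := fun n => 4 * p.eval n + 2) (fun _ _ => Nat.zero_le _) (Finset.mem_range.2 hn)⟩
  have hdec : DecidesGap ξ p
      (RAM.withTable (gapLanguage ξ) b l m (RAM.gapToHC1Q ++ A)) (fun n =>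
        if n < m then 2 * m + 1 + (2 * l + (l * (2 * b + 2) + 1)) else
          2 * m + 1 + 60 * (n + ξ n + 4 * p.eval n + 1) + ⌊(2 : ℝ) ^ ((1 - a) * (n : ℝ))⌋₊) := by
    intro n C hC
    rw [RAM.runsInTime_iff, RAM.nAccepts_iff]
    beta_reduce
    by_cases hn : n < m
    · rw [if_pos hn, ← gapLanguage_gapInput]
      refine RAM.withTable_of_lt _ _ _ _ _ _ hn
        (fun x hx => (le_of_mem_gapInput hx).trans (hb n hn)) ?_
      rw [length_gapInput]
      have := hl n hn
      omega
    · rw [if_neg hn]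
      obtain ⟨ε, hε, hA⟩ := hsample n (by omega) C hC
      exact RAM.haltsIn_and_acceptsIn_iff_of_samples (by omega) (hn₁ n (by omega)) C hε hA _ _ _ _
        (by omega) (by omega)
  -- The gap between a' and a absorbs 2^((1-a)n), while a' < 1 makes 2^((1-a')n) outgrow the
  -- polynomial overhead, also when a ≥ 1.
  obtain ⟨a', ha', haa', ha'1⟩ : ∃ a' : ℝ, 0 < a' ∧ a' < a ∧ a' < 1 :=
    ⟨min a 1 / 2, by positivity, by linarith [min_le_left a 1, lt_min ha one_pos],
      by linarith [min_le_right a 1]⟩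
  have hgrow := eventually_polynomial_add_rpow_le
    -- This is the overhead 2m + 1 + 60(n + ξ(n) + 4p(n) + 1) with ξ(n) replaced by n.
    (Polynomial.C (2 * m + 61) + 120 * Polynomial.X + 240 * p) (c := 1 - a') (d := 1 - a)
    (by linarith) (by linarith)
  refine hp _ _ hdec a' ha' ?_
  filter_upwards [hgrow, eventually_ge_atTop m] with n hgr hn
  rw [not_lt]
  refine le_trans ?_ hgr
  rw [if_neg (by omega)]
  have h1 : 2 * m + 1 + 60 * (n + ξ n + 4 * p.eval n + 1) ≤
      (Polynomial.C (2 * m + 61) + 120 * Polynomial.X + 240 * p).eval n := by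
    have := hn₁ n (by omega)
    simp only [Polynomial.eval_add, Polynomial.eval_mul, Polynomial.eval_X, Polynomial.eval_C,
      Polynomial.eval_ofNat]
    omega
  have h2 : ((⌊(2 : ℝ) ^ ((1 - a) * (n : ℝ))⌋₊ : ℕ) : ℝ) ≤ (2 : ℝ) ^ ((1 - a) * (n : ℝ)) :=
    Nat.floor_le (by positivity)
  rw [Nat.cast_add]
  exact add_le_add (by exact_mod_cast h1) h2
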